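/- **Types.** Pure types are the closed types over $\tau ::= \mathbf{1} \mid \tau\times\tau \mid \tau\to\tau \mid \tau+\tau \mid \alpha \mid \mathsf{rec}\,\alpha.\tau$. They are interpreted as cpos (posets with a least element and all directed suprema): $[\![\mathbf 1]\!]=\{\bot\le\top\}$; $[\![\tau\times\sigma]\!]$ is the product with the componentwise order; $[\![\sigma\to\tau]\!]$ is the set of Scott-continuous functions with the pointwise order; $[\![\tau+\sigma]\!]$ is the disjoint union augmented with a new least element, with injections $\mathrm{in}_1,\mathrm{in}_2$; type expressions with free variables denote functors on cpos and embedding-projection pairs, and $[\![\mathsf{rec}\,\alpha.\tau]\!]$ is the bilimit of the $\omega$-chain of embedding-projection pairs obtained by iterating $[\![\tau]\!]$ in $\alpha$ from the one-point cpo, with the canonical map $\mathrm{unfold}:[\![\mathsf{rec}\,\alpha.\tau]\!]\to[\![\tau[\mathsf{rec}\,\alpha.\tau/\alpha]]\!]$. **Formulae.** Iteration terms are $t::=\iota\mid 0\mid t+1$, with $\iota$ an iteration variable. For $s\in\{\pm,+,-\}$ (with $-\pm=\pm$, $-+=-$, $--=+$), a pure type $\tau$ and a context $\Gamma$ of typed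 fixpoint variables, the set $\mathcal L^s(\Gamma;\tau)$ is defined inductively as follows. * $\mathrm{True},\mathrm{False}\in\mathcal L^s(\Gamma;\tau)$, and $\mathcal L^s(\Gamma;\tau)$ is closed under $\wedge$ and $\vee$; $\langle()\rangle\in\mathcal L^s(\Gamma;\mathbf 1)$; $X\in\mathcal L^s(\Gamma;\tau)$ if $(X:\tau)\in\Gamma$. * If $\varphi\in\mathcal L^s(\Gamma;\tau_i)$ then $\langle\pi_i\rangle\varphi\in\mathcal L^s(\Gamma;\tau_1\times\tau_2)$ and $\langle \mathrm{in}_i\rangle\varphi\in\mathcal L^s(\Gamma;\tau_1+\tau_2)$ ($i=1,2$); if $\varphi\in\mathcal L^s(\Gamma;\tau[\mathsf{rec}\,\alpha.\tau/\alpha])$ then $\langle\mathsf{fold}\rangle\varphi\in\mathcal L^s(\Gamma;\mathsf{rec}\,\alpha.\tau)$. * If $\varphi\in\mathcal L^s(\Gamma,X{:}\tau;\tau)$ and $t$ is an iteration term, then $(\mu^tX)\varphi,(\nu^tX)\varphi\in\mathcal L^s(\Gamma;\tau)$. * If $\varphi\in\mathcal L^+(\Gamma;\tau)$ and $\iota\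 \mathrm{Pos}\ \varphi$ then $(\exists\iota)\varphi\in\mathcal L^+(\Gamma;\tau)$; if $\varphi\in\mathcal L^-(\Gamma;\tau)$ and $\iota\ \mathrm{Neg}\ \varphi$ then $(\forall\iota)\varphi\in\mathcal L^-(\Gamma;\tau)$. * If $\psi\in\mathcal L^{-s}(\,;\sigma)$ and $\varphi\in\mathcal L^s(\,;\tau)$ have no free fixpoint variables, then $(\psi\Rightarrow\varphi)\in\mathcal L^s(\Gamma;\sigma\to\tau)$. The predicates $\mathrm{Pos}$ and $\mathrm{Neg}$ are defined by mutual induction. Both hold of $(\iota,\varphi)$ if $\iota$ is not free in $\varphi$, and both are preserved by $\wedge$, $\vee$ and the modalities $\langle\pi_i\rangle$, $\langle\mathrm{in}_i\rangle$, $\langle\mathsf{fold}\rangle$; $\iota\ \mathrm{Pos}\ (\psi\Rightarrow\varphi)$ if $\iota\ \mathrm{Neg}\ \psi$ and $\iota\ \mathrm{Pos}\ \varphi$, and dually for $\mathrm{Neg}$; $\iota\ \mathrm{Pos}\ \varphi$ implies $\iota\ \mathrm{Pos}\ (\exists\kappa)\varphi$, $\iota\ \mathrm{Pos}\ (\mu^tX)\varphi$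 and, if $\iota$ is not free in $t$, $\iota\ \mathrm{Pos}\ (\nu^tX)\varphi$; dually, $\iota\ \mathrm{Neg}\ \varphi$ implies $\iota\ \mathrm{Neg}\ (\forall\kappa)\varphi$, $\iota\ \mathrm{Neg}\ (\nu^tX)\varphi$ and, if $\iota$ is not free in $t$, $\iota\ \mathrm{Neg}\ (\mu^tX)\varphi$. **Semantics.** Let $v$ be a valuation of the fixpoint variables $X:\tau$ of $\Gamma$ by subsets of $[\![\tau]\!]$ and of the iteration variables by natural numbers. For $\varphi$ of type $\tau$, the set $[\![\varphi]\!]v\subseteq[\![\tau]\!]$ is defined by: $\mathrm{True},\mathrm{False},\wedge,\vee$ denote the whole set, $\emptyset$, $\cap$, $\cup$; $[\![X]\!]v=v(X)$; $[\![\langle()\rangle]\!]v=\{\top\}$; $[\![\langle\pi_i\rangle\varphi]\!]v=\pi_i^{-1}([\![\varphi]\!]v)$; $[\![\langle\mathrm{in}_i\rangle\varphi]\!]v=\mathrm{in}_i([\![\varphi]\!]v)$ (direct image); $[\![\langle\mathsf{fold}\rangle\varphi]\!]v=\mathrm{unfold}^{-1}([\![\varphi]\!]v)$; $[\![\psi\Rightarrow\varphi]\!]v=\{f\mid\forall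 x\in[\![\psi]\!]v,\ f(x)\in[\![\varphi]\!]v\}$; $[\![(\exists\iota)\varphi]\!]v=\bigcup_{n\in\mathbb N}[\![\varphi]\!]v[n/\iota]$; $[\![(\forall\iota)\varphi]\!]v=\bigcap_{n\in\mathbb N}[\![\varphi]\!]v[n/\iota]$; and $[\![(\mu^tX)\varphi]\!]v$, resp. $[\![(\nu^tX)\varphi]\!]v$, is the $[\![t]\!]v$-fold iterate of $S\mapsto[\![\varphi]\!]v[S/X]$ applied to $\emptyset$, resp. to $[\![\tau]\!]$. **Proposition.** For every pure type $\tau$, the cpo $[\![\tau]\!]$ is a Scott domain (a bounded-complete algebraic cpo). Moreover, for every formula $\varphi$ of type $\tau$ without free fixpoint variables and every valuation $v$: 1. if $\varphi\in\mathcal L^+(\tau)$, then $[\![\varphi]\!]v$ is open in the Scott topology of $[\![\tau]\!]$; 2. if $\varphi\in\mathcal L^-(\tau)$, then $[\![\varphi]\!]v$ is compact in the Scott topology and saturated (upward-closed); 3. in particular, if $\varphi\in\mathcal L^\pm(\tau)$, then $[\![\varphi]\!]v$ is compact and open in the Scott topology. -/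

import Mathlib

open CategoryTheory

namespace PolarLogic

/-! ## Complete partial orders and embedding-projection pairs -/

/-- A cpo: a poset with a least element and suprema of all (non-empty) directed subsets. -/
structure Cpo : Type 1 where
  carrier : Type
  [order : PartialOrder carrier]
  exists_bot : ∃ b : carrier, ∀ x, b ≤ x
  exists_lub : ∀ D : Set carrier, D.Nonempty → DirectedOn (· ≤ ·) D → ∃ a, IsLUB D a

instance : CoeSort Cpo Type := ⟨Cpo.carrier⟩

attribute [instance] Cpo.order

/-- A cpo is a Scott domain when it is algebraic (every element is the directed supremum of the
finite elements below it) and bounded-complete. -/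
structure IsScottDomain (X : Cpo) : Prop where
  approx_nonempty : ∀ x : X, {d : X | IsCompactElement d ∧ d ≤ x}.Nonempty
  approx_directed : ∀ x : X, DirectedOn (· ≤ ·) {d : X | IsCompactElement d ∧ d ≤ x}
  approx_isLUB : ∀ x : X, IsLUB {d : X | IsCompactElement d ∧ d ≤ x} x
  bounded_complete : ∀ x y : X, BddAbove {x, y} → ∃ z, IsLUB {x, y} z

/-- The Scott-open sets. -/
def ScottOpen (X : Cpo) (U : Set X) : Prop :=
  @IsOpen X (Topology.scott X Set.univ) U

/-- The sets which are compact for the Scott topology. -/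
def ScottCompact (X : Cpo) (Q : Set X) : Prop :=
  @IsCompact X (Topology.scott X Set.univ) Q

/-- The sets which are compact for the Scott topology and saturated (upward-closed). -/
def CompactSaturated (X : Cpo) (Q : Set X) : Prop :=
  ScottCompact X Q ∧ IsUpperSet Q

/-- The sets which are compact and open for the Scott topology. -/
def CompactOpen (X : Cpo) (K : Set X) : Prop :=
  ScottCompact X K ∧ ScottOpen X K

/-- Embedding-projection pairs of Scott-continuous functions. -/
structure EP (X Y : Cpo) : Type where
  emb : X → Y
  proj : Y → X
  emb_cont : ScottContinuous emb
  proj_cont : ScottContinuous proj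
  proj_emb : ∀ x, proj (emb x) = x
  emb_proj : ∀ y, emb (proj y) ≤ y

/-- The projection determines the embedding. -/
theorem EP.ext_proj {X Y : Cpo} {f g : EP X Y} (h : ∀ y, f.proj y = g.proj y) : f = g := by
  have hp : f.proj = g.proj := funext h
  have he : f.emb = g.emb := by
    funext x
    apply le_antisymm
    · have := f.emb_proj (g.emb x)
      rwa [h, g.proj_emb] at this
    · have := g.emb_proj (f.emb x)
      rwa [← h, f.proj_emb] at this
  cases f
  cases g
  cases hp
  cases he
  rfl

/-- The category of cpos, with embedding-projection pairs as morphisms. -/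
instance : Category Cpo where
  Hom := EP
  id X := ⟨fun x => x, fun x => x, ScottContinuous.id, ScottContinuous.id, fun _ => rfl,
    fun _ => le_rfl⟩
  comp f g := ⟨fun x => g.emb (f.emb x), fun z => f.proj (g.proj z),
    f.emb_cont.comp g.emb_cont, g.proj_cont.comp f.proj_cont,
    fun x => by rw [g.proj_emb, f.proj_emb],
    fun z => (g.emb_cont.monotone (f.emb_proj _)).trans (g.emb_proj z)⟩

theorem hom_ext {X Y : Cpo} {f g : X ⟶ Y} (h : ∀ y, EP.proj f y = EP.proj g y) : f = g :=
  EP.ext_proj h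

@[simp] theorem id_emb (X : Cpo) (x : X) : EP.emb (𝟙 X) x = x := rfl
@[simp] theorem id_proj (X : Cpo) (x : X) : EP.proj (𝟙 X) x = x := rfl
@[simp] theorem comp_emb {X Y Z : Cpo} (f : X ⟶ Y) (g : Y ⟶ Z) (x : X) :
    EP.emb (f ≫ g) x = EP.emb g (EP.emb f x) := rfl
@[simp] theorem comp_proj {X Y Z : Cpo} (f : X ⟶ Y) (g : Y ⟶ Z) (z : Z) :
    EP.proj (f ≫ g) z = EP.proj f (EP.proj g z) := rfl

theorem directedOn_image_of_monotone {α β : Type} [Preorder α] [Preorder β] {f : α → β}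
    (hf : Monotone f) {D : Set α} (hD : DirectedOn (· ≤ ·) D) :
    DirectedOn (· ≤ ·) (f '' D) := by
  rintro _ ⟨a, ha, rfl⟩ _ ⟨b, hb, rfl⟩
  obtain ⟨c, hc, hac, hbc⟩ := hD a ha b hb
  exact ⟨f c, ⟨c, hc, rfl⟩, hf hac, hf hbc⟩

/-! ## The one-point cpo, the two-point cpo and products -/

/-- The one-point cpo. -/
def oneCpo : Cpo where
  carrier := Unit
  exists_bot := ⟨(), fun _ => le_rfl⟩
  exists_lub _ _ _ := ⟨(), fun _ _ => le_rfl, fun _ _ => le_rfl⟩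

/-- The two-point cpo `{⊥ ≤ ⊤}`. -/
def twoCpo : Cpo where
  carrier := Prop
  exists_bot := ⟨⊥, fun _ => bot_le⟩
  exists_lub D _ _ := ⟨sSup D, isLUB_sSup D⟩

/-- The one-point cpo is initial among cpos and embedding-projection pairs. -/
noncomputable def fromOne (X : Cpo) : oneCpo ⟶ X where
  emb _ := X.exists_bot.choose
  proj _ := ()
  emb_cont := ScottContinuous.const _
  proj_cont := ScottContinuous.const _
  proj_emb _ := rfl
  emb_proj := X.exists_bot.choose_spec

theorem fromOne_eq {X : Cpo} (f g : oneCpo ⟶ X) : f = g := hom_ext fun _ => rfl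

/-- The product of two cpos, with the componentwise order. -/
def prodCpo (X Y : Cpo) : Cpo where
  carrier := X × Y
  exists_bot := by
    obtain ⟨a, ha⟩ := X.exists_bot
    obtain ⟨b, hb⟩ := Y.exists_bot
    exact ⟨(a, b), fun p => ⟨ha p.1, hb p.2⟩⟩
  exists_lub D hne hD := by
    obtain ⟨a, ha⟩ := X.exists_lub (Prod.fst '' D) (hne.image _)
      (directedOn_image_of_monotone monotone_fst hD)
    obtain ⟨b, hb⟩ := Y.exists_lub (Prod.snd '' D) (hne.image _)
      (directedOn_image_of_monotone monotone_snd hD)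
    exact ⟨(a, b), isLUB_prod.2 ⟨ha, hb⟩⟩

/-- The action of products on embedding-projection pairs. -/
def prodEP {X X' Y Y' : Cpo} (f : X ⟶ X') (g : Y ⟶ Y') : prodCpo X Y ⟶ prodCpo X' Y' where
  emb := Prod.map (EP.emb f) (EP.emb g)
  proj := Prod.map (EP.proj f) (EP.proj g)
  emb_cont := (EP.emb_cont f).prod (EP.emb_cont g)
  proj_cont := (EP.proj_cont f).prod (EP.proj_cont g)
  proj_emb p := Prod.ext (EP.proj_emb f p.1) (EP.proj_emb g p.2)
  emb_proj p := ⟨EP.emb_proj f p.1, EP.emb_proj g p.2⟩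

/-! ## Function spaces -/

theorem exists_pointwise_lub {X Y : Cpo} (D : Set {f : X → Y // ScottContinuous f})
    (hne : D.Nonempty) (hD : DirectedOn (· ≤ ·) D) :
    ∃ g : {f : X → Y // ScottContinuous f}, IsLUB D g ∧
      ∀ x, IsLUB ((fun f : {f : X → Y // ScottContinuous f} => f.1 x) '' D) (g.1 x) := by
  have h : ∀ x : X, ∃ a, IsLUB ((fun f : {f : X → Y // ScottContinuous f} => f.1 x) '' D) a :=
    fun x => Y.exists_lub _ (hne.image _)
      (directedOn_image_of_monotone (fun (f f' : {f : X → Y // ScottContinuous f}) hff => (show f.1 ≤ f'.1 from hff) x) hD)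
  choose g hg using h
  have hmono : Monotone g := fun x y hxy => (hg x).2 <| by
    rintro _ ⟨f, hf, rfl⟩
    exact (f.2.monotone hxy).trans ((hg y).1 ⟨f, hf, rfl⟩)
  have hc : ScottContinuous g := by
    intro d hd hdd a ha
    refine ⟨hmono.mem_upperBounds_image ha.1, fun b hb => (hg a).2 ?_⟩
    rintro _ ⟨f, hf, rfl⟩
    refine (f.2 hd hdd ha).2 ?_
    rintro _ ⟨x, hx, rfl⟩
    exact ((hg x).1 ⟨f, hf, rfl⟩).trans (hb ⟨x, hx, rfl⟩)
  refine ⟨⟨g, hc⟩, ⟨fun f hf x => (hg x).1 ⟨f, hf, rfl⟩, fun f hf x => (hg x).2 ?_⟩, hg⟩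
  rintro _ ⟨f', hf', rfl⟩
  exact hf hf' x

/-- The cpo of Scott-continuous functions, with the pointwise order. -/
def funCpo (X Y : Cpo) : Cpo where
  carrier := {f : X → Y // ScottContinuous f}
  exists_bot := by
    obtain ⟨b, hb⟩ := Y.exists_bot
    exact ⟨⟨fun _ => b, ScottContinuous.const b⟩, fun f x => hb (f.1 x)⟩
  exists_lub D hne hD := by
    obtain ⟨g, hg, _⟩ := exists_pointwise_lub D hne hD
    exact ⟨g, hg⟩

theorem conjugate_cont {X X' Y Y' : Cpo} {p : X' → X} (hp : ScottContinuous p)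
    {e : Y → Y'} (he : ScottContinuous e) :
    ScottContinuous (fun φ : funCpo X Y =>
      (⟨fun x => e (φ.1 (p x)), (hp.comp φ.2).comp he⟩ : funCpo X' Y')) := by
  intro D hne hD φ hφ
  obtain ⟨g, hg, hgx⟩ := exists_pointwise_lub D hne hD
  obtain rfl : g = φ := hg.unique hφ
  have key : ∀ x, IsLUB (e '' ((fun f : funCpo X Y => f.1 (p x)) '' D)) (e (g.1 (p x))) :=
    fun x => he (hne.image _)
      (directedOn_image_of_monotone (fun (f f' : funCpo X Y) hff => (show f.1 ≤ f'.1 from hff) (p x)) hD) (hgx (p x))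
  refine ⟨?_, fun ψ hψ x => (key x).2 ?_⟩
  · rintro _ ⟨f, hf, rfl⟩ x
    exact (key x).1 ⟨_, ⟨f, hf, rfl⟩, rfl⟩
  · rintro _ ⟨_, ⟨f, hf, rfl⟩, rfl⟩
    exact hψ ⟨f, hf, rfl⟩ x

/-- The action of function spaces on embedding-projection pairs. -/
def funEP {X X' Y Y' : Cpo} (f : X ⟶ X') (g : Y ⟶ Y') : funCpo X Y ⟶ funCpo X' Y' where
  emb φ := ⟨fun x => EP.emb g (φ.1 (EP.proj f x)),
    ((EP.proj_cont f).comp φ.2).comp (EP.emb_cont g)⟩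
  proj ψ := ⟨fun x => EP.proj g (ψ.1 (EP.emb f x)),
    ((EP.emb_cont f).comp ψ.2).comp (EP.proj_cont g)⟩
  emb_cont := conjugate_cont (EP.proj_cont f) (EP.emb_cont g)
  proj_cont := conjugate_cont (EP.emb_cont f) (EP.proj_cont g)
  proj_emb φ := Subtype.ext <| funext fun x => by
    simp only [EP.proj_emb]
  emb_proj ψ x := (EP.emb_proj g _).trans (ψ.2.monotone (EP.emb_proj f x))

/-! ## Weak sums -/

theorem isLUB_of_preimage {X S : Type} [PartialOrder X] [PartialOrder S] {i : X → S}
    (hi : ∀ x y, i x ≤ i y ↔ x ≤ y) (hup : ∀ x s, i x ≤ s → ∃ y, i y = s)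
    {D : Set S} (hD : DirectedOn (· ≤ ·) D) {x₀ : X} (hx₀ : i x₀ ∈ D) {a : X}
    (ha : IsLUB (i ⁻¹' D) a) : IsLUB D (i a) := by
  refine ⟨fun y hy => ?_, fun b hb => ?_⟩
  · obtain ⟨z, hz, hyz, hxz⟩ := hD y hy _ hx₀
    obtain ⟨z', rfl⟩ := hup _ _ hxz
    exact hyz.trans ((hi _ _).2 (ha.1 hz))
  · obtain ⟨b', rfl⟩ := hup _ _ (hb hx₀)
    exact (hi _ _).2 (ha.2 fun y hy => (hi _ _).1 (hb hy))

theorem directedOn_preimage {X S : Type} [PartialOrder X] [PartialOrder S] {i : X → S}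
    (hi : ∀ x y, i x ≤ i y ↔ x ≤ y) (hup : ∀ x s, i x ≤ s → ∃ y, i y = s)
    {D : Set S} (hD : DirectedOn (· ≤ ·) D) : DirectedOn (· ≤ ·) (i ⁻¹' D) := by
  intro x hx y hy
  obtain ⟨z, hz, hxz, hyz⟩ := hD _ hx _ hy
  obtain ⟨z', rfl⟩ := hup _ _ hxz
  exact ⟨z', hz, (hi _ _).1 hxz, (hi _ _).1 hyz⟩

/-- The first injection into the disjoint union with a new least element. -/
def sumInl {X Y : Type} (x : X) : WithBot (X ⊕ Y) := ((Sum.inl x : X ⊕ Y) : WithBot (X ⊕ Y))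

/-- The second injection into the disjoint union with a new least element. -/
def sumInr {X Y : Type} (y : Y) : WithBot (X ⊕ Y) := ((Sum.inr y : X ⊕ Y) : WithBot (X ⊕ Y))

theorem sum_cases {X Y : Type} (s : WithBot (X ⊕ Y)) :
    s = ⊥ ∨ (∃ x, s = sumInl x) ∨ ∃ y, s = sumInr y := by
  rcases s with _ | (x | y)
  · exact Or.inl rfl
  · exact Or.inr (Or.inl ⟨x, rfl⟩)
  · exact Or.inr (Or.inr ⟨y, rfl⟩)

section SumOrder

variable {X Y : Type} [PartialOrder X] [PartialOrder Y]

theorem sumInl_le_iff (x y : X) : (sumInl x : WithBot (X ⊕ Y)) ≤ sumInl y ↔ x ≤ y := by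
  simp [sumInl]

theorem sumInr_le_iff (x y : Y) : (sumInr x : WithBot (X ⊕ Y)) ≤ sumInr y ↔ x ≤ y := by
  simp [sumInr]

theorem sumInl_up (x : X) (s : WithBot (X ⊕ Y)) (h : sumInl x ≤ s) : ∃ y, sumInl y = s := by
  rcases sum_cases s with rfl | ⟨y, rfl⟩ | ⟨y, rfl⟩
  · simp [sumInl] at h
  · exact ⟨y, rfl⟩
  · simp [sumInl, sumInr] at h

theorem sumInr_up (x : Y) (s : WithBot (X ⊕ Y)) (h : sumInr x ≤ s) : ∃ y, sumInr y = s := by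
  rcases sum_cases s with rfl | ⟨y, rfl⟩ | ⟨y, rfl⟩
  · simp [sumInr] at h
  · simp [sumInl, sumInr] at h
  · exact ⟨y, rfl⟩

end SumOrder

/-- The weak coproduct of two cpos: their disjoint union, augmented with a new least element. -/
def sumCpo (X Y : Cpo) : Cpo where
  carrier := WithBot (X ⊕ Y)
  exists_bot := ⟨⊥, fun _ => bot_le⟩
  exists_lub D hne hD := by
    by_cases h₁ : ∃ x : X, sumInl x ∈ D
    · obtain ⟨x₀, hx₀⟩ := h₁
      obtain ⟨a, ha⟩ := X.exists_lub _ ⟨x₀, hx₀⟩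
        (directedOn_preimage sumInl_le_iff sumInl_up hD)
      exact ⟨_, isLUB_of_preimage sumInl_le_iff sumInl_up hD hx₀ ha⟩
    by_cases h₂ : ∃ y : Y, sumInr y ∈ D
    · obtain ⟨x₀, hx₀⟩ := h₂
      obtain ⟨a, ha⟩ := Y.exists_lub _ ⟨x₀, hx₀⟩
        (directedOn_preimage sumInr_le_iff sumInr_up hD)
      exact ⟨_, isLUB_of_preimage sumInr_le_iff sumInr_up hD hx₀ ha⟩
    refine ⟨⊥, fun s hs => ?_, fun _ _ => bot_le⟩
    rcases sum_cases s with rfl | ⟨y, rfl⟩ | ⟨y, rfl⟩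
    · exact le_rfl
    · exact (h₁ ⟨y, hs⟩).elim
    · exact (h₂ ⟨y, hs⟩).elim

theorem sumMap_cont {X X' Y Y' : Cpo} {f : X → X'} (hf : ScottContinuous f)
    {g : Y → Y'} (hg : ScottContinuous g) :
    ScottContinuous (WithBot.map (Sum.map f g) : sumCpo X Y → sumCpo X' Y') := by
  have hmono : Monotone (WithBot.map (Sum.map f g) : WithBot (X ⊕ Y) → WithBot (X' ⊕ Y')) :=
    WithBot.monotone_map_iff.2 <| by
      rintro (x | x) (y | y) h
      · simpa using hf.monotone (by simpa using h)
      · simp at h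
      · simp at h
      · simpa using hg.monotone (by simpa using h)
  intro D hne hD a ha
  have hD' := directedOn_image_of_monotone hmono hD
  by_cases h₁ : ∃ x : X, sumInl x ∈ D
  · obtain ⟨x₀, hx₀⟩ := h₁
    have hpd := directedOn_preimage sumInl_le_iff sumInl_up hD
    obtain ⟨a', ha'⟩ := X.exists_lub _ ⟨x₀, hx₀⟩ hpd
    obtain rfl := (isLUB_of_preimage sumInl_le_iff sumInl_up hD hx₀ ha').unique ha
    have hlub := hf ⟨x₀, hx₀⟩ hpd ha'
    refine isLUB_of_preimage (X := X') (i := sumInl) sumInl_le_iff sumInl_up hD'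
      (x₀ := f x₀) ⟨_, hx₀, rfl⟩ ?_
    convert hlub using 1
    ext z
    constructor
    · rintro ⟨s, hs, hsz⟩
      rcases sum_cases s with rfl | ⟨y, rfl⟩ | ⟨y, rfl⟩
      · exact (WithBot.bot_ne_coe hsz).elim
      · exact ⟨y, hs, Sum.inl_injective (WithBot.coe_injective hsz)⟩
      · exact (Sum.inr_ne_inl (WithBot.coe_injective hsz)).elim
    · rintro ⟨y, hy, rfl⟩
      exact ⟨sumInl y, hy, rfl⟩
  by_cases h₂ : ∃ y : Y, sumInr y ∈ D
  · obtain ⟨x₀, hx₀⟩ := h₂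
    have hpd := directedOn_preimage sumInr_le_iff sumInr_up hD
    obtain ⟨a', ha'⟩ := Y.exists_lub _ ⟨x₀, hx₀⟩ hpd
    obtain rfl := (isLUB_of_preimage sumInr_le_iff sumInr_up hD hx₀ ha').unique ha
    have hlub := hg ⟨x₀, hx₀⟩ hpd ha'
    refine isLUB_of_preimage (X := Y') (i := sumInr) sumInr_le_iff sumInr_up hD'
      (x₀ := g x₀) ⟨_, hx₀, rfl⟩ ?_
    convert hlub using 1
    ext z
    constructor
    · rintro ⟨s, hs, hsz⟩
      rcases sum_cases s with rfl | ⟨y, rfl⟩ | ⟨y, rfl⟩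
      · exact (WithBot.bot_ne_coe hsz).elim
      · exact (Sum.inl_ne_inr (WithBot.coe_injective hsz)).elim
      · exact ⟨y, hs, Sum.inr_injective (WithBot.coe_injective hsz)⟩
    · rintro ⟨y, hy, rfl⟩
      exact ⟨sumInr y, hy, rfl⟩
  have hbot : ∀ s ∈ D, s = (⊥ : WithBot (X ⊕ Y)) := fun s hs => by
    rcases sum_cases s with rfl | ⟨y, rfl⟩ | ⟨y, rfl⟩
    · rfl
    · exact (h₁ ⟨y, hs⟩).elim
    · exact (h₂ ⟨y, hs⟩).elim
  obtain ⟨s₀, hs₀⟩ := hne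
  have haD : a ∈ D := by
    have h1 : a ≤ s₀ := ha.2 fun s hs => by rw [hbot s hs, hbot s₀ hs₀]
    have h2 : s₀ ≤ a := ha.1 hs₀
    rwa [le_antisymm h1 h2]
  exact ⟨hmono.mem_upperBounds_image ha.1, fun b hb => hb ⟨a, haD, rfl⟩⟩

/-- The action of weak sums on embedding-projection pairs. -/
def sumEP {X X' Y Y' : Cpo} (f : X ⟶ X') (g : Y ⟶ Y') : sumCpo X Y ⟶ sumCpo X' Y' where
  emb := WithBot.map (Sum.map (EP.emb f) (EP.emb g))
  proj := WithBot.map (Sum.map (EP.proj f) (EP.proj g))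
  emb_cont := sumMap_cont (EP.emb_cont f) (EP.emb_cont g)
  proj_cont := sumMap_cont (EP.proj_cont f) (EP.proj_cont g)
  proj_emb s := by
    rcases sum_cases s with rfl | ⟨y, rfl⟩ | ⟨y, rfl⟩
    · rfl
    · exact congrArg sumInl (EP.proj_emb f y)
    · exact congrArg sumInr (EP.proj_emb g y)
  emb_proj s := by
    rcases sum_cases s with rfl | ⟨y, rfl⟩ | ⟨y, rfl⟩
    · exact le_rfl
    · exact (sumInl_le_iff _ _).2 (EP.emb_proj f y)
    · exact (sumInr_le_iff _ _).2 (EP.emb_proj g y)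

/-! ## Bilimits of countable chains of embedding-projection pairs -/

section Bilimit

/-- The poset underlying the limit of the chain of projections. -/
def LimCarrier (K : ℕ → Cpo) (k : ∀ n, K n ⟶ K (n + 1)) : Type :=
  {x : ∀ n, K n // ∀ n, EP.proj (k n) (x (n + 1)) = x n}

instance (K : ℕ → Cpo) (k : ∀ n, K n ⟶ K (n + 1)) : PartialOrder (LimCarrier K k) :=
  inferInstanceAs (PartialOrder {x : ∀ n, K n // ∀ n, EP.proj (k n) (x (n + 1)) = x n})

theorem exists_lim_lub {K : ℕ → Cpo} {k : ∀ n, K n ⟶ K (n + 1)} (D : Set (LimCarrier K k))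
    (hne : D.Nonempty) (hD : DirectedOn (· ≤ ·) D) :
    ∃ a : LimCarrier K k, IsLUB D a ∧
      ∀ n, IsLUB ((fun x : LimCarrier K k => x.1 n) '' D) (a.1 n) := by
  have hdir : ∀ n, DirectedOn (· ≤ ·) ((fun x : LimCarrier K k => x.1 n) '' D) := fun n =>
    directedOn_image_of_monotone (fun (x y : LimCarrier K k) hxy => (show x.1 ≤ y.1 from hxy) n) hD
  choose a ha using fun n => (K n).exists_lub _ (hne.image _) (hdir n)
  refine ⟨⟨a, fun n => ?_⟩, ⟨fun x hx n => (ha n).1 ⟨x, hx, rfl⟩, fun b hb n => (ha n).2 ?_⟩, ha⟩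
  · have h := EP.proj_cont (k n) (hne.image _) (hdir (n + 1)) (ha (n + 1))
    refine h.unique ?_
    rw [Set.image_image]
    simpa only [fun x : LimCarrier K k => x.2 n] using ha n
  · rintro _ ⟨x, hx, rfl⟩
    exact hb hx n

/-- The bilimit of a chain of embedding-projection pairs: the limit of its projections, with the
pointwise order. -/
def limCpo (K : ℕ → Cpo) (k : ∀ n, K n ⟶ K (n + 1)) : Cpo where
  carrier := LimCarrier K k
  exists_bot := by
    choose b hb using fun n => (K n).exists_bot
    refine ⟨⟨b, fun n => le_antisymm ?_ (hb n _)⟩, fun x n => hb n (x.1 n)⟩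
    calc EP.proj (k n) (b (n + 1))
        ≤ EP.proj (k n) (EP.emb (k n) (b n)) := (EP.proj_cont (k n)).monotone (hb _ _)
      _ = b n := EP.proj_emb _ _
  exists_lub D hne hD := by
    obtain ⟨a, ha, _⟩ := exists_lim_lub D hne hD
    exact ⟨a, ha⟩

/-- The canonical map from the `n`th to the `m`th object of a chain, composed of embeddings
if `n ≤ m` and of projections if `m ≤ n`. -/
def chainHom : (K : ℕ → Cpo) → (k : ∀ n, K n ⟶ K (n + 1)) → (n m : ℕ) → K n → K m
  | _, _, 0, 0 => fun x => x
  | K, k, 0, m + 1 => fun x => EP.emb (k m) (chainHom K k 0 m x)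
  | K, k, n + 1, 0 => fun x => chainHom K k n 0 (EP.proj (k n) x)
  | K, k, n + 1, m + 1 => chainHom (fun i => K (i + 1)) (fun i => k (i + 1)) n m

theorem chainHom_cont : (K : ℕ → Cpo) → (k : ∀ n, K n ⟶ K (n + 1)) → (n m : ℕ) →
    ScottContinuous (chainHom K k n m)
  | _, _, 0, 0 => by
    unfold chainHom
    exact ScottContinuous.id
  | K, k, 0, m + 1 => by
    unfold chainHom
    exact (chainHom_cont K k 0 m).comp (EP.emb_cont (k m))
  | K, k, n + 1, 0 => by
    unfold chainHom
    exact (EP.proj_cont (k n)).comp (chainHom_cont K k n 0)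
  | K, k, n + 1, m + 1 => by
    unfold chainHom
    exact chainHom_cont _ _ n m

theorem chainHom_self : (K : ℕ → Cpo) → (k : ∀ n, K n ⟶ K (n + 1)) → (n : ℕ) → (x : K n) →
    chainHom K k n n x = x
  | _, _, 0, x => by
    unfold chainHom
    rfl
  | K, k, n + 1, x => by
    unfold chainHom
    exact chainHom_self (fun i => K (i + 1)) (fun i => k (i + 1)) n x

theorem chainHom_zero_proj (K : ℕ → Cpo) (k : ∀ n, K n ⟶ K (n + 1)) : (n : ℕ) → (x : K (n + 1)) →
    EP.proj (k 0) (chainHom (fun i => K (i + 1)) (fun i => k (i + 1)) n 0 x) =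
      chainHom K k n 0 (EP.proj (k n) x)
  | 0, x => by
    simp [chainHom]
  | n + 1, x => by
    have := chainHom_zero_proj K k n (EP.proj (k (n + 1)) x)
    simpa [chainHom] using this

theorem chainHom_proj : (K : ℕ → Cpo) → (k : ∀ n, K n ⟶ K (n + 1)) → (n m : ℕ) → (x : K n) →
    EP.proj (k m) (chainHom K k n (m + 1) x) = chainHom K k n m x
  | K, k, 0, m, x => by
    rw [chainHom]
    exact EP.proj_emb _ _
  | K, k, n + 1, 0, x => by
    rw [chainHom, chainHom]
    exact chainHom_zero_proj K k n x
  | K, k, n + 1, m + 1, x => by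
    rw [chainHom, chainHom]
    exact chainHom_proj (fun i => K (i + 1)) (fun i => k (i + 1)) n m x

theorem chainHom_le : (K : ℕ → Cpo) → (k : ∀ n, K n ⟶ K (n + 1)) → (n m : ℕ) →
    (x : ∀ n, K n) → (∀ n, EP.proj (k n) (x (n + 1)) = x n) → chainHom K k n m (x n) ≤ x m
  | K, k, 0, 0, x, _ => by
    rw [chainHom]
  | K, k, 0, m + 1, x, hx => by
    rw [chainHom]
    refine ((EP.emb_cont (k m)).monotone (chainHom_le K k 0 m x hx)).trans ?_
    rw [← hx m]
    exact EP.emb_proj _ _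
  | K, k, n + 1, 0, x, hx => by
    rw [chainHom]
    have h := chainHom_le K k n 0 x hx
    rwa [← hx n] at h
  | K, k, n + 1, m + 1, x, hx => by
    rw [chainHom]
    exact chainHom_le (fun i => K (i + 1)) (fun i => k (i + 1)) n m (fun i => x (i + 1))
      (fun i => hx (i + 1))

variable {K : ℕ → Cpo} {k : ∀ n, K n ⟶ K (n + 1)}

theorem lim_isLUB_apply {D : Set (limCpo K k)} (hne : D.Nonempty) (hD : DirectedOn (· ≤ ·) D)
    {a : limCpo K k} (ha : IsLUB D a) (n : ℕ) :
    IsLUB ((fun x : limCpo K k => x.1 n) '' D) (a.1 n) := by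
  obtain ⟨a', ha', hn⟩ := exists_lim_lub D hne hD
  obtain rfl : a' = a := ha'.unique ha
  exact hn n

theorem lim_cont_of_apply {X : Cpo} {f : X → limCpo K k}
    (hf : ∀ n, ScottContinuous fun x => (f x).1 n) : ScottContinuous f := by
  intro D hne hD a ha
  have key := fun n => hf n hne hD ha
  refine ⟨?_, fun b hb n => (key n).2 ?_⟩
  · rintro _ ⟨x, hx, rfl⟩ n
    exact (key n).1 ⟨x, hx, rfl⟩
  · rintro _ ⟨x, hx, rfl⟩
    exact hb ⟨x, hx, rfl⟩ n

variable (K k)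

/-- The components of the colimiting cocone of a bilimit; the projections are the components of
the limiting cone. -/
def limIn (n : ℕ) : K n ⟶ limCpo K k where
  emb x := ⟨fun m => chainHom K k n m x, fun m => chainHom_proj K k n m x⟩
  proj x := x.1 n
  emb_cont := lim_cont_of_apply fun m => chainHom_cont K k n m
  proj_cont _ hne hD _ ha := lim_isLUB_apply hne hD ha n
  proj_emb x := chainHom_self K k n x
  emb_proj x m := chainHom_le K k n m x.1 x.2

theorem limIn_comp (n : ℕ) : k n ≫ limIn K k (n + 1) = limIn K k n :=
  hom_ext fun x => x.2 n

variable {K k} {C : Cpo} (t : ∀ n, K n ⟶ C)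

theorem cocone_proj (ht : ∀ n, k n ≫ t (n + 1) = t n) (n : ℕ) (y : C) :
    EP.proj (k n) (EP.proj (t (n + 1)) y) = EP.proj (t n) y := by
  rw [← ht n]
  rfl

theorem cocone_emb_mono (ht : ∀ n, k n ≫ t (n + 1) = t n) (x : limCpo K k) :
    Monotone fun n => EP.emb (t n) (x.1 n) :=
  monotone_nat_of_le_succ fun n => by
    rw [← ht n, ← x.2 n]
    exact (EP.emb_cont (t (n + 1))).monotone (EP.emb_proj _ _)

theorem exists_descEmb (ht : ∀ n, k n ≫ t (n + 1) = t n) (x : limCpo K k) :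
    ∃ a, IsLUB (Set.range fun n => EP.emb (t n) (x.1 n)) a :=
  C.exists_lub _ (Set.range_nonempty _)
    (directedOn_range.2 (cocone_emb_mono t ht x).directed_le)

/-- The embedding of the mediating morphism out of a bilimit. -/
noncomputable def descEmb (ht : ∀ n, k n ≫ t (n + 1) = t n) (x : limCpo K k) : C := (exists_descEmb t ht x).choose

theorem descEmb_isLUB (ht : ∀ n, k n ≫ t (n + 1) = t n) (x : limCpo K k) :
    IsLUB (Set.range fun n => EP.emb (t n) (x.1 n)) (descEmb t ht x) :=
  (exists_descEmb t ht x).choose_spec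

theorem cocone_proj_of_le (ht : ∀ n, k n ≫ t (n + 1) = t n) {x : limCpo K k} {n : ℕ}
    {z : C} (hz : EP.proj (t n) z = x.1 n) :
    ∀ m, m ≤ n → EP.proj (t m) z = x.1 m := by
  intro m hm
  induction hm using Nat.decreasingInduction with
  | self => exact hz
  | of_succ j hj ih => rw [← cocone_proj t ht, ih, x.2]

/-- The mediating morphism out of a bilimit, given by its colimit property. -/
noncomputable def limDesc (ht : ∀ n, k n ≫ t (n + 1) = t n) : limCpo K k ⟶ C where
  emb := descEmb t ht
  proj y := ⟨fun n => EP.proj (t n) y, fun n => cocone_proj t ht n y⟩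
  emb_cont := by
    intro D hne hD a ha
    have key : ∀ n, IsLUB (EP.emb (t n) '' ((fun x : limCpo K k => x.1 n) '' D))
        (EP.emb (t n) (a.1 n)) := fun n =>
      EP.emb_cont (t n) (hne.image _)
        (directedOn_image_of_monotone (fun (x y : limCpo K k) hxy => (show x.1 ≤ y.1 from hxy) n) hD)
        (lim_isLUB_apply hne hD ha n)
    refine ⟨?_, fun b hb => (descEmb_isLUB t ht a).2 ?_⟩
    · rintro _ ⟨x, hx, rfl⟩
      refine (descEmb_isLUB t ht x).2 ?_
      rintro _ ⟨n, rfl⟩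
      exact ((key n).1 ⟨_, ⟨x, hx, rfl⟩, rfl⟩).trans ((descEmb_isLUB t ht a).1 ⟨n, rfl⟩)
    · rintro _ ⟨n, rfl⟩
      refine (key n).2 ?_
      rintro _ ⟨_, ⟨x, hx, rfl⟩, rfl⟩
      exact ((descEmb_isLUB t ht x).1 ⟨n, rfl⟩).trans (hb ⟨x, hx, rfl⟩)
  proj_cont := lim_cont_of_apply fun n => EP.proj_cont (t n)
  proj_emb x := by
    refine Subtype.ext (funext fun m => ?_)
    have h := EP.proj_cont (t m) (Set.range_nonempty _)
      (directedOn_range.2 (cocone_emb_mono t ht x).directed_le) (descEmb_isLUB t ht x)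
    refine le_antisymm (h.2 ?_) ?_
    · rintro _ ⟨_, ⟨n, rfl⟩, rfl⟩
      rcases le_total m n with hmn | hnm
      · exact (cocone_proj_of_le t ht (EP.proj_emb (t n) _) m hmn).le
      · refine ((EP.proj_cont (t m)).monotone (cocone_emb_mono t ht x hnm)).trans ?_
        exact (EP.proj_emb (t m) _).le
    · refine le_trans ?_ (h.1 ⟨_, ⟨m, rfl⟩, rfl⟩)
      exact (EP.proj_emb (t m) _).ge
  emb_proj y := (descEmb_isLUB t ht _).2 <| by
    rintro _ ⟨n, rfl⟩
    exact EP.emb_proj (t n) y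

end Bilimit

/-! ## Functors on cpos and embedding-projection pairs -/

/-- Interpretations of `n` type variables. -/
abbrev Env (n : ℕ) : Type 1 := Fin n → Cpo

/-- Extension of an environment by a cpo for the variable `0`. -/
def Env.cons {n : ℕ} (A : Cpo) (X : Env n) : Env (n + 1) := Fin.cons A X

/-- Extension of a morphism of environments. -/
def consMap {n : ℕ} {A B : Cpo} {X Y : Env n} (f : A ⟶ B) (g : X ⟶ Y) :
    Env.cons A X ⟶ Env.cons B Y :=
  fun i => Fin.cases (motive := fun i => Env.cons A X i ⟶ Env.cons B Y i) f g i

theorem consMap_id {n : ℕ} (A : Cpo) (X : Env n) :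
    consMap (𝟙 A) (𝟙 X) = 𝟙 (Env.cons A X) := by
  funext i
  refine Fin.cases ?_ (fun i => ?_) i <;> rfl

theorem consMap_comp {n : ℕ} {A B C : Cpo} {X Y Z : Env n} (f : A ⟶ B) (f' : B ⟶ C)
    (g : X ⟶ Y) (g' : Y ⟶ Z) :
    consMap (f ≫ f') (g ≫ g') = consMap f g ≫ consMap f' g' := by
  funext i
  refine Fin.cases ?_ (fun i => ?_) i <;> rfl

section Functors

variable {n : ℕ}

/-- Products of functors. -/
def prodF (F G : Env n ⥤ Cpo) : Env n ⥤ Cpo where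
  obj X := prodCpo (F.obj X) (G.obj X)
  map f := prodEP (F.map f) (G.map f)
  map_id X := by
    rw [F.map_id, G.map_id]
    exact hom_ext fun _ => rfl
  map_comp f g := by
    rw [F.map_comp, G.map_comp]
    exact hom_ext fun _ => rfl

/-- Function spaces of functors. -/
def funF (F G : Env n ⥤ Cpo) : Env n ⥤ Cpo where
  obj X := funCpo (F.obj X) (G.obj X)
  map f := funEP (F.map f) (G.map f)
  map_id X := by
    rw [F.map_id, G.map_id]
    exact hom_ext fun _ => rfl
  map_comp f g := by
    rw [F.map_comp, G.map_comp]
    exact hom_ext fun _ => rfl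

/-- Weak sums of functors. -/
def sumF (F G : Env n ⥤ Cpo) : Env n ⥤ Cpo where
  obj X := sumCpo (F.obj X) (G.obj X)
  map f := sumEP (F.map f) (G.map f)
  map_id X := by
    rw [F.map_id, G.map_id]
    refine hom_ext fun s => ?_
    rcases sum_cases s with rfl | ⟨y, rfl⟩ | ⟨y, rfl⟩ <;> rfl
  map_comp f g := by
    rw [F.map_comp, G.map_comp]
    refine hom_ext fun s => ?_
    rcases sum_cases s with rfl | ⟨y, rfl⟩ | ⟨y, rfl⟩ <;> rfl

variable (F : Env (n + 1) ⥤ Cpo)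

/-- The objects `1, F(1), F(F(1)), …` of the chain obtained by iterating `F` in its variable `0`
from the initial cpo. -/
noncomputable def chainObj (X : Env n) (m : ℕ) : Cpo :=
  Nat.rec oneCpo (fun _ A => F.obj (Env.cons A X)) m

/-- The connecting morphisms of the chain: the first one is given by initiality, and the
`m + 1`st one is the image under `F` of the `m`th one. -/
noncomputable def chainStep (X : Env n) (m : ℕ) : chainObj F X m ⟶ chainObj F X (m + 1) :=
  Nat.rec (motive := fun m => chainObj F X m ⟶ chainObj F X (m + 1)) (fromOne _)
    (fun _ k => F.map (consMap k (𝟙 X))) m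

/-- The action of a morphism of environments on the chain. -/
noncomputable def chainMap {X Y : Env n} (f : X ⟶ Y) (m : ℕ) : chainObj F X m ⟶ chainObj F Y m :=
  Nat.rec (motive := fun m => chainObj F X m ⟶ chainObj F Y m) (𝟙 oneCpo)
    (fun _ g => F.map (consMap g f)) m

theorem chainMap_step {X Y : Env n} (f : X ⟶ Y) : ∀ m,
    chainStep F X m ≫ chainMap F f (m + 1) = chainMap F f m ≫ chainStep F Y m
  | 0 => fromOne_eq _ _
  | m + 1 =>
    calc F.map (consMap (chainStep F X m) (𝟙 X)) ≫ F.map (consMap (chainMap F f (m + 1)) f)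
        = F.map (consMap (chainStep F X m ≫ chainMap F f (m + 1)) (𝟙 X ≫ f)) := by
          rw [consMap_comp, F.map_comp]
      _ = F.map (consMap (chainMap F f m ≫ chainStep F Y m) (f ≫ 𝟙 Y)) := by
          rw [chainMap_step f m, Category.id_comp, Category.comp_id]
      _ = F.map (consMap (chainMap F f m) f) ≫ F.map (consMap (chainStep F Y m) (𝟙 Y)) := by
          rw [consMap_comp, F.map_comp]

theorem chainMap_id (X : Env n) : ∀ m, chainMap F (𝟙 X) m = 𝟙 _
  | 0 => rfl
  | m + 1 =>
    calc F.map (consMap (chainMap F (𝟙 X) m) (𝟙 X)) = F.map (𝟙 _) := by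
          rw [chainMap_id X m, consMap_id]
      _ = 𝟙 _ := F.map_id _

theorem chainMap_comp {X Y Z : Env n} (f : X ⟶ Y) (g : Y ⟶ Z) : ∀ m,
    chainMap F (f ≫ g) m = chainMap F f m ≫ chainMap F g m
  | 0 => rfl
  | m + 1 =>
    calc F.map (consMap (chainMap F (f ≫ g) m) (f ≫ g))
        = F.map (consMap (chainMap F f m) f) ≫ F.map (consMap (chainMap F g m) g) := by
          rw [chainMap_comp f g m, consMap_comp, F.map_comp]

/-- The bilimit of the chain, as a functor of the environment, for a given natural family of
connecting morphisms. -/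
noncomputable def limF (k : ∀ X m, chainObj F X m ⟶ chainObj F X (m + 1))
    (hk : ∀ {X Y : Env n} (f : X ⟶ Y) (m : ℕ),
      k X m ≫ chainMap F f (m + 1) = chainMap F f m ≫ k Y m) : Env n ⥤ Cpo where
  obj X := limCpo (chainObj F X) (k X)
  map {X Y} f := limDesc (fun m => chainMap F f m ≫ limIn _ (k Y) m) fun m => by
    rw [← Category.assoc, hk, Category.assoc, limIn_comp]
  map_id X := hom_ext fun y => Subtype.ext <| funext fun m => by
    change EP.proj (chainMap F (𝟙 X) m) (y.1 m) = y.1 m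
    rw [chainMap_id]
    rfl
  map_comp f g := hom_ext fun y => Subtype.ext <| funext fun m => by
    change EP.proj (chainMap F (f ≫ g) m) (y.1 m) =
      EP.proj (chainMap F f m) (EP.proj (chainMap F g m) (y.1 m))
    rw [chainMap_comp]
    rfl

theorem limF_congr {k k' : ∀ X m, chainObj F X m ⟶ chainObj F X (m + 1)} (h : k = k')
    (hk : ∀ {X Y : Env n} (f : X ⟶ Y) (m : ℕ),
      k X m ≫ chainMap F f (m + 1) = chainMap F f m ≫ k Y m)
    (hk' : ∀ {X Y : Env n} (f : X ⟶ Y) (m : ℕ),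
      k' X m ≫ chainMap F f (m + 1) = chainMap F f m ≫ k' Y m) :
    limF F k hk = limF F k' hk' := by
  subst h
  rfl

/-- The parametrised solution of the domain equation `A ≅ F(A)`: the bilimit of the chain
obtained by iterating `F` in its variable `0` from the initial cpo. -/
noncomputable def recF : Env n ⥤ Cpo :=
  limF F (chainStep F) (chainMap_step F)

/-- The cocone with vertex `F(Fix F)` over the chain. -/
noncomputable def unfoldCocone (X : Env n) :
    ∀ m, chainObj F X m ⟶ F.obj (Env.cons ((recF F).obj X) X)
  | 0 => fromOne _
  | m + 1 => F.map (consMap (limIn (chainObj F X) (chainStep F X) m) (𝟙 X))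

theorem unfoldCocone_comp (X : Env n) : ∀ m,
    chainStep F X m ≫ unfoldCocone F X (m + 1) = unfoldCocone F X m
  | 0 => fromOne_eq _ _
  | m + 1 =>
    calc F.map (consMap (chainStep F X m) (𝟙 X)) ≫
          F.map (consMap (limIn (chainObj F X) (chainStep F X) (m + 1)) (𝟙 X))
        = F.map (consMap (limIn (chainObj F X) (chainStep F X) m) (𝟙 X)) := by
          rw [← F.map_comp, ← consMap_comp, limIn_comp, Category.comp_id]

/-- The canonical comparison `Fix F ⟶ F(Fix F)` out of the bilimit. -/
noncomputable def unfoldHom (X : Env n) :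
    (recF F).obj X ⟶ F.obj (Env.cons ((recF F).obj X) X) :=
  limDesc (unfoldCocone F X) (unfoldCocone_comp F X)

end Functors

/-! ## Pure types and their interpretation -/

/-- Type expressions with `n` free type variables (as de Bruijn indices);
`recTy` binds the variable `0`. -/
inductive Ty : ℕ → Type
  | unit {n : ℕ} : Ty n
  | prod {n : ℕ} (S T : Ty n) : Ty n
  | arrow {n : ℕ} (S T : Ty n) : Ty n
  | sum {n : ℕ} (S T : Ty n) : Ty n
  | var {n : ℕ} (i : Fin n) : Ty n
  | recTy {n : ℕ} (T : Ty (n + 1)) : Ty n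

/-- Pure types are closed type expressions. -/
abbrev PureTy : Type := Ty 0

namespace Ty

def liftRen {m n : ℕ} (r : Fin m → Fin n) : Fin (m + 1) → Fin (n + 1) :=
  Fin.cases 0 (fun i => (r i).succ)

def rename : {m n : ℕ} → (Fin m → Fin n) → Ty m → Ty n
  | _, _, _, unit => unit
  | _, _, r, prod S T => prod (S.rename r) (T.rename r)
  | _, _, r, arrow S T => arrow (S.rename r) (T.rename r)
  | _, _, r, sum S T => sum (S.rename r) (T.rename r)
  | _, _, r, var i => var (r i)
  | _, _, r, recTy T => recTy (T.rename (liftRen r))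

def liftSubst {m n : ℕ} (s : Fin m → Ty n) : Fin (m + 1) → Ty (n + 1) :=
  Fin.cases (var 0) (fun i => (s i).rename Fin.succ)

/-- Capture-avoiding simultaneous substitution. -/
def subst : {m n : ℕ} → (Fin m → Ty n) → Ty m → Ty n
  | _, _, _, unit => unit
  | _, _, s, prod S T => prod (S.subst s) (T.subst s)
  | _, _, s, arrow S T => arrow (S.subst s) (T.subst s)
  | _, _, s, sum S T => sum (S.subst s) (T.subst s)
  | _, _, s, var i => s i
  | _, _, s, recTy T => recTy (T.subst (liftSubst s))

/-- Substitution of `U` for the variable `0` in `T`. -/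
def inst {n : ℕ} (T : Ty (n + 1)) (U : Ty n) : Ty n :=
  T.subst (Fin.cases U var)

/-- The interpretation of a type expression, as a functor on cpos and embedding-projection
pairs. -/
noncomputable def sem : {n : ℕ} → Ty n → (Env n ⥤ Cpo)
  | _, unit => (Functor.const _).obj twoCpo
  | _, prod S T => prodF S.sem T.sem
  | _, arrow S T => funF S.sem T.sem
  | _, sum S T => sumF S.sem T.sem
  | _, var i => Pi.eval (fun _ => Cpo) i
  | _, recTy T => recF T.sem

end Ty

/-! ### The interpretation of substitution -/

/-- Forgetting the variable `0`. -/
def tailF (n : ℕ) : Env (n + 1) ⥤ Env n := Functor.pi' fun i => Pi.eval (fun _ => Cpo) i.succ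

/-- The action of a functor of environments below the variable `0`. -/
def liftF {m n : ℕ} (H : Env n ⥤ Env m) : Env (n + 1) ⥤ Env (m + 1) where
  obj X := Env.cons (X 0) (H.obj fun i => X i.succ)
  map {X Y} f := consMap (f 0) (H.map (X := fun i => X i.succ) (Y := fun i => Y i.succ)
    fun i => f i.succ)
  map_id X := by
    rw [← consMap_id, ← H.map_id]
    rfl
  map_comp f g := by
    rw [← consMap_comp, ← H.map_comp]
    rfl

theorem chainStep_liftF {m n : ℕ} (H : Env n ⥤ Env m) (F : Env (m + 1) ⥤ Cpo) (X : Env n) :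
    ∀ j, chainStep (liftF H ⋙ F) X j = chainStep F (H.obj X) j
  | 0 => rfl
  | j + 1 => by
    have ih := chainStep_liftF H F X j
    change F.map (consMap (chainStep (liftF H ⋙ F) X j) (H.map (𝟙 X))) =
      F.map (consMap (chainStep F (H.obj X) j) (𝟙 (H.obj X)))
    rw [H.map_id, ih]
    rfl

theorem recF_liftF {m n : ℕ} (H : Env n ⥤ Env m) (F : Env (m + 1) ⥤ Cpo) :
    recF (liftF H ⋙ F) = H ⋙ recF F :=
  limF_congr (liftF H ⋙ F) (funext fun X => funext fun j => chainStep_liftF H F X j)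
    (chainMap_step _) (fun f j => chainMap_step F (H.map f) j)

theorem liftF_pi {m n : ℕ} (G : Fin m → (Env n ⥤ Cpo)) (G' : Fin (m + 1) → (Env (n + 1) ⥤ Cpo))
    (h₀ : G' 0 = Pi.eval (fun _ => Cpo) 0) (hs : ∀ i, G' i.succ = tailF n ⋙ G i) :
    Functor.pi' G' = liftF (Functor.pi' G) := by
  refine Functor.pi_ext _ _ fun i => ?_
  refine Fin.cases ?_ (fun i => ?_) i
  · exact h₀
  · exact hs i

namespace Ty

theorem sem_rename : {m n : ℕ} → (r : Fin m → Fin n) → (T : Ty m) →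
    (T.rename r).sem = Functor.pi' (fun i => Pi.eval (fun _ => Cpo) (r i)) ⋙ T.sem
  | _, _, _, unit => rfl
  | _, _, r, prod S T => by
    rw [rename, sem, sem_rename r S, sem_rename r T]
    rfl
  | _, _, r, arrow S T => by
    rw [rename, sem, sem_rename r S, sem_rename r T]
    rfl
  | _, _, r, sum S T => by
    rw [rename, sem, sem_rename r S, sem_rename r T]
    rfl
  | _, _, _, var _ => rfl
  | _, _, r, recTy T => by
    rw [rename, sem, sem_rename (liftRen r) T,
      liftF_pi (fun i => Pi.eval (fun _ => Cpo) (r i)) _ rfl (fun i => rfl), recF_liftF]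
    rfl

theorem sem_subst : {m n : ℕ} → (s : Fin m → Ty n) → (T : Ty m) →
    (T.subst s).sem = Functor.pi' (fun i => (s i).sem) ⋙ T.sem
  | _, _, _, unit => rfl
  | _, _, s, prod S T => by
    rw [subst, sem, sem_subst s S, sem_subst s T]
    rfl
  | _, _, s, arrow S T => by
    rw [subst, sem, sem_subst s S, sem_subst s T]
    rfl
  | _, _, s, sum S T => by
    rw [subst, sem, sem_subst s S, sem_subst s T]
    rfl
  | _, _, _, var _ => rfl
  | _, _, s, recTy T => by
    rw [subst, sem, sem_subst (liftSubst s) T,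
      liftF_pi (fun i => (s i).sem) _ rfl (fun i => sem_rename Fin.succ (s i)), recF_liftF]
    rfl

theorem sem_inst_obj {n : ℕ} (T : Ty (n + 1)) (U : Ty n) (X : Env n) :
    (T.inst U).sem.obj X = T.sem.obj (Env.cons (U.sem.obj X) X) := by
  rw [inst, sem_subst]
  refine congrArg T.sem.obj (funext fun i => ?_)
  refine Fin.cases ?_ (fun i => ?_) i <;> rfl

/-- The cpo interpreting a pure type. -/
noncomputable def dom (T : PureTy) : Cpo := T.sem.obj Fin.elim0

/-- The unfolding map, from a recursive type to its unfolding: the embedding part of the canonical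
comparison morphism, along the equality of the interpretation of `T[rec T]` with that of `T` at the
interpretation of `rec T`. -/
noncomputable def unfold (T : Ty 1) : dom (recTy T) → dom (T.inst (recTy T)) :=
  EP.emb (unfoldHom T.sem Fin.elim0 ≫ eqToHom (sem_inst_obj T (recTy T) Fin.elim0).symm)

end Ty

/-! ## Formulae -/

/-- Iteration terms; iteration variables are natural numbers. -/
inductive IterTerm : Type
  | var (i : ℕ)
  | zero
  | succ (t : IterTerm)

namespace IterTerm

def freeVars : IterTerm → Set ℕ
  | var i => {i}
  | zero => ∅
  | succ t => t.freeVars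

def eval (r : ℕ → ℕ) : IterTerm → ℕ
  | var i => r i
  | zero => 0
  | succ t => t.eval r + 1

end IterTerm

/-- Fixpoint contexts: the list of the types of the fixpoint variables. -/
abbrev Ctx : Type := List PureTy

/-- `FPVar Γ T` is the type of (de Bruijn) fixpoint variables of type `T` in the context `Γ`. -/
inductive FPVar : Ctx → PureTy → Type
  | here {Γ : Ctx} {T : PureTy} : FPVar (T :: Γ) T
  | there {Γ : Ctx} {S T : PureTy} (x : FPVar Γ T) : FPVar (S :: Γ) T

open Ty in
/-- Raw formulae of type `T` in the fixpoint context `Γ`, regardless of polarities. The binders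
`mu t` and `nu t` (bounded iteration) bind the fixpoint variable `FPVar.here`; the quantifiers
`ex i` and `all i` bind the iteration variable `i`. -/
inductive Form : Ctx → PureTy → Type
  | tt {Γ : Ctx} {T : PureTy} : Form Γ T
  | ff {Γ : Ctx} {T : PureTy} : Form Γ T
  | and {Γ : Ctx} {T : PureTy} (φ ψ : Form Γ T) : Form Γ T
  | or {Γ : Ctx} {T : PureTy} (φ ψ : Form Γ T) : Form Γ T
  | pair {Γ : Ctx} : Form Γ unit
  | fst {Γ : Ctx} {S T : PureTy} (φ : Form Γ S) : Form Γ (prod S T)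
  | snd {Γ : Ctx} {S T : PureTy} (φ : Form Γ T) : Form Γ (prod S T)
  | inl {Γ : Ctx} {S T : PureTy} (φ : Form Γ S) : Form Γ (sum S T)
  | inr {Γ : Ctx} {S T : PureTy} (φ : Form Γ T) : Form Γ (sum S T)
  | fold {Γ : Ctx} {T : Ty 1} (φ : Form Γ (T.inst (recTy T))) : Form Γ (recTy T)
  | fpvar {Γ : Ctx} {T : PureTy} (x : FPVar Γ T) : Form Γ T
  | mu {Γ : Ctx} {T : PureTy} (t : IterTerm) (φ : Form (T :: Γ) T) : Form Γ T
  | nu {Γ : Ctx} {T : PureTy} (t : IterTerm) (φ : Form (T :: Γ) T) : Form Γ T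
  | ex {Γ : Ctx} {T : PureTy} (i : ℕ) (φ : Form Γ T) : Form Γ T
  | all {Γ : Ctx} {T : PureTy} (i : ℕ) (φ : Form Γ T) : Form Γ T
  | realto {Γ : Ctx} {S T : PureTy} (ψ : Form [] S) (φ : Form [] T) : Form Γ (arrow S T)

/-- The free iteration variables of a formula. -/
def Form.freeVars : {Γ : Ctx} → {T : PureTy} → Form Γ T → Set ℕ
  | _, _, .tt => ∅
  | _, _, .ff => ∅
  | _, _, .and φ ψ => φ.freeVars ∪ ψ.freeVars
  | _, _, .or φ ψ => φ.freeVars ∪ ψ.freeVars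
  | _, _, .pair => ∅
  | _, _, .fst φ => φ.freeVars
  | _, _, .snd φ => φ.freeVars
  | _, _, .inl φ => φ.freeVars
  | _, _, .inr φ => φ.freeVars
  | _, _, .fold φ => φ.freeVars
  | _, _, .fpvar _ => ∅
  | _, _, .mu t φ => t.freeVars ∪ φ.freeVars
  | _, _, .nu t φ => t.freeVars ∪ φ.freeVars
  | _, _, .ex i φ => φ.freeVars \ {i}
  | _, _, .all i φ => φ.freeVars \ {i}
  | _, _, .realto ψ φ => ψ.freeVars ∪ φ.freeVars

mutual

/-- `PosIn i φ`: the iteration variable `i` occurs positively in `φ`. -/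
inductive PosIn : ℕ → {Γ : Ctx} → {T : PureTy} → Form Γ T → Prop
  | notFree {i : ℕ} {Γ : Ctx} {T : PureTy} {φ : Form Γ T} : i ∉ φ.freeVars → PosIn i φ
  | and {i : ℕ} {Γ : Ctx} {T : PureTy} {φ ψ : Form Γ T} :
      PosIn i φ → PosIn i ψ → PosIn i (Form.and φ ψ)
  | or {i : ℕ} {Γ : Ctx} {T : PureTy} {φ ψ : Form Γ T} :
      PosIn i φ → PosIn i ψ → PosIn i (Form.or φ ψ)
  | fst {i : ℕ} {Γ : Ctx} {S T : PureTy} {φ : Form Γ S} :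
      PosIn i φ → PosIn i (Form.fst (T := T) φ)
  | snd {i : ℕ} {Γ : Ctx} {S T : PureTy} {φ : Form Γ T} :
      PosIn i φ → PosIn i (Form.snd (S := S) φ)
  | inl {i : ℕ} {Γ : Ctx} {S T : PureTy} {φ : Form Γ S} :
      PosIn i φ → PosIn i (Form.inl (T := T) φ)
  | inr {i : ℕ} {Γ : Ctx} {S T : PureTy} {φ : Form Γ T} :
      PosIn i φ → PosIn i (Form.inr (S := S) φ)
  | fold {i : ℕ} {Γ : Ctx} {T : Ty 1} {φ : Form Γ (T.inst (Ty.recTy T))} :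
      PosIn i φ → PosIn i (Form.fold φ)
  | realto {i : ℕ} {Γ : Ctx} {S T : PureTy} {ψ : Form [] S} {φ : Form [] T} :
      NegIn i ψ → PosIn i φ → PosIn i (Form.realto (Γ := Γ) ψ φ)
  | ex {i j : ℕ} {Γ : Ctx} {T : PureTy} {φ : Form Γ T} : PosIn i φ → PosIn i (Form.ex j φ)
  | mu {i : ℕ} {Γ : Ctx} {T : PureTy} {t : IterTerm} {φ : Form (T :: Γ) T} :
      PosIn i φ → PosIn i (Form.mu t φ)
  | nu {i : ℕ} {Γ : Ctx} {T : PureTy} {t : IterTerm} {φ : Form (T :: Γ) T} :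
      PosIn i φ → i ∉ t.freeVars → PosIn i (Form.nu t φ)

/-- `NegIn i φ`: the iteration variable `i` occurs negatively in `φ`. -/
inductive NegIn : ℕ → {Γ : Ctx} → {T : PureTy} → Form Γ T → Prop
  | notFree {i : ℕ} {Γ : Ctx} {T : PureTy} {φ : Form Γ T} : i ∉ φ.freeVars → NegIn i φ
  | and {i : ℕ} {Γ : Ctx} {T : PureTy} {φ ψ : Form Γ T} :
      NegIn i φ → NegIn i ψ → NegIn i (Form.and φ ψ)
  | or {i : ℕ} {Γ : Ctx} {T : PureTy} {φ ψ : Form Γ T} :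
      NegIn i φ → NegIn i ψ → NegIn i (Form.or φ ψ)
  | fst {i : ℕ} {Γ : Ctx} {S T : PureTy} {φ : Form Γ S} :
      NegIn i φ → NegIn i (Form.fst (T := T) φ)
  | snd {i : ℕ} {Γ : Ctx} {S T : PureTy} {φ : Form Γ T} :
      NegIn i φ → NegIn i (Form.snd (S := S) φ)
  | inl {i : ℕ} {Γ : Ctx} {S T : PureTy} {φ : Form Γ S} :
      NegIn i φ → NegIn i (Form.inl (T := T) φ)
  | inr {i : ℕ} {Γ : Ctx} {S T : PureTy} {φ : Form Γ T} :
      NegIn i φ → NegIn i (Form.inr (S := S) φ)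
  | fold {i : ℕ} {Γ : Ctx} {T : Ty 1} {φ : Form Γ (T.inst (Ty.recTy T))} :
      NegIn i φ → NegIn i (Form.fold φ)
  | realto {i : ℕ} {Γ : Ctx} {S T : PureTy} {ψ : Form [] S} {φ : Form [] T} :
      PosIn i ψ → NegIn i φ → NegIn i (Form.realto (Γ := Γ) ψ φ)
  | all {i j : ℕ} {Γ : Ctx} {T : PureTy} {φ : Form Γ T} : NegIn i φ → NegIn i (Form.all j φ)
  | nu {i : ℕ} {Γ : Ctx} {T : PureTy} {t : IterTerm} {φ : Form (T :: Γ) T} :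
      NegIn i φ → NegIn i (Form.nu t φ)
  | mu {i : ℕ} {Γ : Ctx} {T : PureTy} {t : IterTerm} {φ : Form (T :: Γ) T} :
      NegIn i φ → i ∉ t.freeVars → NegIn i (Form.mu t φ)

end

/-- The polarities `±`, `+` and `-`. -/
inductive Sign : Type
  | neutral
  | pos
  | neg

def Sign.opp : Sign → Sign
  | neutral => neutral
  | pos => neg
  | neg => pos

/-- `Lang s φ`: the formula `φ`, of type `T` in the fixpoint context `Γ`, has polarity `s`. -/
inductive Lang : Sign → {Γ : Ctx} → {T : PureTy} → Form Γ T → Prop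
  | tt {s : Sign} {Γ : Ctx} {T : PureTy} : Lang s (Form.tt : Form Γ T)
  | ff {s : Sign} {Γ : Ctx} {T : PureTy} : Lang s (Form.ff : Form Γ T)
  | and {s : Sign} {Γ : Ctx} {T : PureTy} {φ ψ : Form Γ T} :
      Lang s φ → Lang s ψ → Lang s (Form.and φ ψ)
  | or {s : Sign} {Γ : Ctx} {T : PureTy} {φ ψ : Form Γ T} :
      Lang s φ → Lang s ψ → Lang s (Form.or φ ψ)
  | pair {s : Sign} {Γ : Ctx} : Lang s (Form.pair : Form Γ Ty.unit)
  | fst {s : Sign} {Γ : Ctx} {S T : PureTy} {φ : Form Γ S} :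
      Lang s φ → Lang s (Form.fst (T := T) φ)
  | snd {s : Sign} {Γ : Ctx} {S T : PureTy} {φ : Form Γ T} :
      Lang s φ → Lang s (Form.snd (S := S) φ)
  | inl {s : Sign} {Γ : Ctx} {S T : PureTy} {φ : Form Γ S} :
      Lang s φ → Lang s (Form.inl (T := T) φ)
  | inr {s : Sign} {Γ : Ctx} {S T : PureTy} {φ : Form Γ T} :
      Lang s φ → Lang s (Form.inr (S := S) φ)
  | fold {s : Sign} {Γ : Ctx} {T : Ty 1} {φ : Form Γ (T.inst (Ty.recTy T))} :
      Lang s φ → Lang s (Form.fold φ)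
  | fpvar {s : Sign} {Γ : Ctx} {T : PureTy} (x : FPVar Γ T) : Lang s (Form.fpvar x)
  | mu {s : Sign} {Γ : Ctx} {T : PureTy} {t : IterTerm} {φ : Form (T :: Γ) T} :
      Lang s φ → Lang s (Form.mu t φ)
  | nu {s : Sign} {Γ : Ctx} {T : PureTy} {t : IterTerm} {φ : Form (T :: Γ) T} :
      Lang s φ → Lang s (Form.nu t φ)
  | ex {i : ℕ} {Γ : Ctx} {T : PureTy} {φ : Form Γ T} :
      Lang Sign.pos φ → PosIn i φ → Lang Sign.pos (Form.ex i φ)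
  | all {i : ℕ} {Γ : Ctx} {T : PureTy} {φ : Form Γ T} :
      Lang Sign.neg φ → NegIn i φ → Lang Sign.neg (Form.all i φ)
  | realto {s : Sign} {Γ : Ctx} {S T : PureTy} {ψ : Form [] S} {φ : Form [] T} :
      Lang s.opp ψ → Lang s φ → Lang s (Form.realto (Γ := Γ) ψ φ)

/-! ## Semantics of formulae -/

/-- Valuations of the fixpoint variables of a context. -/
def FPVal (Γ : Ctx) : Type := ∀ T : PureTy, FPVar Γ T → Set T.dom

/-- The valuation of the empty fixpoint context. -/
def FPVal.nil : FPVal [] := fun _ x => nomatch x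

/-- Extension of a valuation by a value for the variable `FPVar.here`. -/
def FPVal.cons {Γ : Ctx} {S : PureTy} (P : Set S.dom) (v : FPVal Γ) : FPVal (S :: Γ)
  | _, .here => P
  | _, .there x => v _ x

/-- The interpretation of a formula under a valuation `v` of its fixpoint variables and a valuation
`r` of the iteration variables. The formulae `mu t φ` and `nu t φ` denote the `t`-fold iteration of
`φ` as a function of its fixpoint variable, from falsity and from truth respectively. -/
noncomputable def Form.sem : {Γ : Ctx} → {T : PureTy} → Form Γ T → FPVal Γ → (ℕ → ℕ) → Set T.dom
  | _, _, .tt, _, _ => Set.univ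
  | _, _, .ff, _, _ => ∅
  | _, _, .and φ ψ, v, r => φ.sem v r ∩ ψ.sem v r
  | _, _, .or φ ψ, v, r => φ.sem v r ∪ ψ.sem v r
  | _, _, .pair, _, _ => ({(⊤ : Prop)} : Set Prop)
  | _, _, .fst (S := S) (T := T) φ, v, r => {p : S.dom × T.dom | p.1 ∈ φ.sem v r}
  | _, _, .snd (S := S) (T := T) φ, v, r => {p : S.dom × T.dom | p.2 ∈ φ.sem v r}
  | _, _, .inl (S := S) (T := T) φ, v, r =>
      (sumInl '' φ.sem v r : Set (WithBot (S.dom ⊕ T.dom)))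
  | _, _, .inr (S := S) (T := T) φ, v, r =>
      (sumInr '' φ.sem v r : Set (WithBot (S.dom ⊕ T.dom)))
  | _, _, .fold φ, v, r => {x | Ty.unfold _ x ∈ φ.sem v r}
  | _, _, .fpvar x, v, _ => v _ x
  | _, _, .mu t φ, v, r => (fun P => φ.sem (FPVal.cons P v) r)^[t.eval r] ∅
  | _, _, .nu t φ, v, r => (fun P => φ.sem (FPVal.cons P v) r)^[t.eval r] Set.univ
  | _, _, .ex i φ, v, r => ⋃ n : ℕ, φ.sem v (Function.update r i n)
  | _, _, .all i φ, v, r => ⋂ n : ℕ, φ.sem v (Function.update r i n)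
  | _, _, .realto (S := S) (T := T) ψ φ, _, r =>
      {f : {f : S.dom → T.dom // ScottContinuous f} |
        ∀ x ∈ ψ.sem FPVal.nil r, f.1 x ∈ φ.sem FPVal.nil r}

end PolarLogic

/-!
Formulae of polarity `+` denote Scott-open sets and formulae of polarity `-` denote sets closed in
the lower topology; on a Scott domain the latter are Scott-compact and saturated. Indeed an
ultrafilter converges, in the Scott and in the lower topology alike, to the supremum of the compact
elements `d` with `Ici d` in the ultrafilter, and that limit lies in every lower-closed set of the
ultrafilter.

Working with lower-closed rather than compact sets makes negative formulae stable under
intersections and modalities. The modalities are direct images under inclusions of summands and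
preimages under Scott-continuous right adjoints; unfolding is one of the latter because it is an
isomorphism, the interpretation of types being ω-continuous. An implication with a positive premise
may be tested at the compact elements of the premise, where evaluation is right adjoint to the
formation of step functions. An implication with a negative premise is Scott-open by compactness of
the premise.
-/

namespace PolarLogic

open Set Topology

section CompactElements

variable {α β : Type*} [PartialOrder α] [PartialOrder β]

theorem isLUB_pair_iff {x y z : α} : IsLUB {x, y} z ↔ ∀ b, z ≤ b ↔ x ≤ b ∧ y ≤ b := by
  simp only [isLUB_iff_le_iff, upperBounds_insert, upperBounds_singleton, mem_inter_iff, mem_Ici]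

theorem bddAbove_pair_iff {x y : α} : BddAbove {x, y} ↔ ∃ b, x ≤ b ∧ y ≤ b := by
  simp only [BddAbove, Set.Nonempty, upperBounds_insert, upperBounds_singleton, mem_inter_iff,
    mem_Ici]

theorem isCompactElement_of_isBot {b : α} (hb : IsBot b) : IsCompactElement b :=
  fun _ _ ⟨x, hx⟩ _ _ _ => ⟨x, hx, hb x⟩

theorem isCompactElement_of_isLUB_pair {d e z : α} (hd : IsCompactElement d)
    (he : IsCompactElement e) (hz : IsLUB {d, e} z) : IsCompactElement z := by
  intro D a hne hD ha hza
  obtain ⟨hda, hea⟩ := (isLUB_pair_iff.1 hz a).1 hza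
  obtain ⟨x, hx, hdx⟩ := hd D a hne hD ha hda
  obtain ⟨y, hy, hey⟩ := he D a hne hD ha hea
  obtain ⟨w, hw, hxw, hyw⟩ := hD x hx y hy
  exact ⟨w, hw, (isLUB_pair_iff.1 hz w).2 ⟨hdx.trans hxw, hey.trans hyw⟩⟩

theorem isCompactElement_leftAdjoint {l : α → β} {u : β → α} (gc : GaloisConnection l u)
    (hu : ScottContinuous u) {d : α} (hd : IsCompactElement d) : IsCompactElement (l d) := by
  intro D a hne hD ha hda
  obtain ⟨_, ⟨x, hx, rfl⟩, hdx⟩ := hd _ _ (hne.image u)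
    (directedOn_image.2 (hD.mono @(hu.monotone))) (hu hne hD ha) ((gc d a).1 hda)
  exact ⟨x, hx, (gc d x).2 hdx⟩

end CompactElements

section ScottDomain

theorem IsScottDomain.of_le {X : Cpo}
    (hle : ∀ x b : X, (∀ d, IsCompactElement d → d ≤ x → d ≤ b) → x ≤ b)
    (hsup : ∀ x y b : X, x ≤ b → y ≤ b → ∃ z, IsLUB {x, y} z) : IsScottDomain X where
  approx_nonempty x := by
    obtain ⟨b, hb⟩ := X.exists_bot
    exact ⟨b, isCompactElement_of_isBot hb, hb x⟩
  approx_directed x := by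
    rintro d ⟨hd, hdx⟩ e ⟨he, hex⟩
    obtain ⟨z, hz⟩ := hsup d e x hdx hex
    exact ⟨z, ⟨isCompactElement_of_isLUB_pair hd he hz, (isLUB_pair_iff.1 hz x).2 ⟨hdx, hex⟩⟩,
      (isLUB_pair_iff.1 hz z).1 le_rfl⟩
  approx_isLUB x := ⟨fun _ hd => hd.2, fun b hb => hle x b fun _ hd hdx => hb ⟨hd, hdx⟩⟩
  bounded_complete x y hxy := by
    obtain ⟨b, hx, hy⟩ := bddAbove_pair_iff.1 hxy
    exact hsup x y b hx hy

theorem IsScottDomain.exists_isLUB_pair {X : Cpo} (hX : IsScottDomain X) {x y b : X}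
    (hx : x ≤ b) (hy : y ≤ b) : ∃ z, IsLUB {x, y} z :=
  hX.bounded_complete x y (bddAbove_pair_iff.2 ⟨b, hx, hy⟩)

theorem IsScottDomain.le_of_forall_isCompactElement {X : Cpo} (hX : IsScottDomain X) {x b : X}
    (h : ∀ d, IsCompactElement d → d ≤ x → d ≤ b) : x ≤ b :=
  (hX.approx_isLUB x).2 fun d hd => h d hd.1 hd.2

theorem IsScottDomain.rightAdjoint_le_of_forall_isCompactElement {X Y : Cpo}
    (hY : IsScottDomain Y) {l : Y → X} {u : X → Y} (gc : GaloisConnection l u)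
    (hu : ScottContinuous u) {x b : X} (h : ∀ d, IsCompactElement d → d ≤ x → d ≤ b) :
    u x ≤ u b :=
  hY.le_of_forall_isCompactElement fun d hd hdx =>
    (gc d b).1 (h (l d) (isCompactElement_leftAdjoint gc hu hd) ((gc d x).2 hdx))

theorem isScottDomain_oneCpo : IsScottDomain oneCpo :=
  .of_le (fun _ _ _ => le_rfl) fun _ _ _ _ _ => ⟨(), fun _ _ => le_rfl, fun _ _ => le_rfl⟩

end ScottDomain

section ScottOpen

variable {X Y : Cpo} {U V : Set X}

theorem scottOpen_iff : ScottOpen X U ↔ IsUpperSet U ∧ DirSupInacc U := by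
  let _ : TopologicalSpace X := Topology.scott X Set.univ
  have : IsScott X Set.univ := ⟨rfl⟩
  rw [ScottOpen, IsScott.isOpen_iff_isUpperSet_and_dirSupInaccOn (D := Set.univ),
    dirSupInaccOn_univ]

theorem scottOpen_Ici_iff {d : X} : ScottOpen X (Ici d) ↔ IsCompactElement d := by
  rw [scottOpen_iff]
  exact ⟨fun h D a hne hD ha hda => h.2 hne hD ha hda,
    fun hd => ⟨isUpperSet_Ici d, fun D hne hD a ha hda => hd D a hne hD ha hda⟩⟩

theorem ScottOpen.univ (X : Cpo) : ScottOpen X Set.univ := @isOpen_univ X (Topology.scott X _)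

theorem ScottOpen.empty (X : Cpo) : ScottOpen X ∅ := @isOpen_empty X (Topology.scott X _)

theorem ScottOpen.inter (hU : ScottOpen X U) (hV : ScottOpen X V) : ScottOpen X (U ∩ V) :=
  @IsOpen.inter X (Topology.scott X _) U V hU hV

theorem ScottOpen.union (hU : ScottOpen X U) (hV : ScottOpen X V) : ScottOpen X (U ∪ V) :=
  @IsOpen.union X U V (Topology.scott X _) hU hV

theorem ScottOpen.iUnion {ι : Sort*} {U : ι → Set X} (hU : ∀ i, ScottOpen X (U i)) :
    ScottOpen X (⋃ i, U i) :=
  @isOpen_iUnion X ι (Topology.scott X _) U hU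

theorem ScottOpen.preimage {f : X → Y} (hf : ScottContinuous f) {U : Set Y}
    (hU : ScottOpen Y U) : ScottOpen X (f ⁻¹' U) := by
  rw [scottOpen_iff] at hU ⊢
  refine ⟨hU.1.preimage hf.monotone, fun D hne hD a ha haU => ?_⟩
  obtain ⟨_, ⟨x, hx, rfl⟩, hxU⟩ := hU.2 (hne.image f)
    (directedOn_image_of_monotone hf.monotone hD) (hf hne hD ha) haU
  exact ⟨x, hx, hxU⟩

theorem ScottOpen.exists_isCompactElement_le (hX : IsScottDomain X) (hU : ScottOpen X U) {x : X}
    (hx : x ∈ U) : ∃ d ∈ U, IsCompactElement d ∧ d ≤ x := by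
  obtain ⟨d, hd, hdU⟩ := (scottOpen_iff.1 hU).2 (hX.approx_nonempty x) (hX.approx_directed x)
    (hX.approx_isLUB x) hx
  exact ⟨d, hdU, hd⟩

end ScottOpen

section LowerClosed

variable {X Y : Cpo} {P Q : Set X}

/-- The closed sets of the lower topology, that is, the intersections of finite unions of sets
`Ici a`. On a Scott domain they are the compact saturated sets; unlike these, they are visibly
stable under intersections and under preimages by right adjoints. -/
def LowerClosed (X : Cpo) (Q : Set X) : Prop :=
  @IsClosed X (Topology.lower X) Q

theorem LowerClosed.isUpperSet (hQ : LowerClosed X Q) : IsUpperSet Q :=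
  letI : TopologicalSpace X := Topology.lower X
  haveI : IsLower X := ⟨rfl⟩
  IsLower.isUpperSet_of_isClosed hQ

theorem LowerClosed.Ici (a : X) : LowerClosed X (Ici a) :=
  letI : TopologicalSpace X := Topology.lower X
  haveI : IsLower X := ⟨rfl⟩
  isClosed_Ici

theorem LowerClosed.univ (X : Cpo) : LowerClosed X Set.univ :=
  @isClosed_univ X (Topology.lower X)

theorem LowerClosed.empty (X : Cpo) : LowerClosed X ∅ := @isClosed_empty X (Topology.lower X)

theorem LowerClosed.inter (hP : LowerClosed X P) (hQ : LowerClosed X Q) :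
    LowerClosed X (P ∩ Q) :=
  @IsClosed.inter X P Q (Topology.lower X) hP hQ

theorem LowerClosed.union (hP : LowerClosed X P) (hQ : LowerClosed X Q) :
    LowerClosed X (P ∪ Q) :=
  @IsClosed.union X P Q (Topology.lower X) hP hQ

theorem LowerClosed.iInter {ι : Sort*} {Q : ι → Set X} (hQ : ∀ i, LowerClosed X (Q i)) :
    LowerClosed X (⋂ i, Q i) :=
  @isClosed_iInter X ι (Topology.lower X) Q hQ

theorem LowerClosed.preimage {f : X → Y} (hf : ∀ a, LowerClosed X (f ⁻¹' Set.Ici a)) {Q : Set Y}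
    (hQ : LowerClosed Y Q) : LowerClosed X (f ⁻¹' Q) :=
  letI : TopologicalSpace X := Topology.lower X
  letI : TopologicalSpace Y := Topology.lower Y
  haveI : IsLower Y := ⟨rfl⟩
  IsClosed.preimage (IsLower.continuous_iff_Ici.2 hf) hQ

theorem LowerClosed.preimage_rightAdjoint {l : Y → X} {u : X → Y} (gc : GaloisConnection l u)
    {Q : Set Y} (hQ : LowerClosed Y Q) : LowerClosed X (u ⁻¹' Q) :=
  hQ.preimage fun a => by
    have : u ⁻¹' Set.Ici a = Set.Ici (l a) := Set.ext fun x => (gc a x).symm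
    exact this ▸ LowerClosed.Ici (l a)

theorem IsScottDomain.exists_forall_le_iff_Ici_mem (hX : IsScottDomain X) (f : Ultrafilter X) :
    ∃ x : X, ∀ d, IsCompactElement d → (d ≤ x ↔ Set.Ici d ∈ f) := by
  let D := {d : X | IsCompactElement d ∧ Set.Ici d ∈ f}
  have hne : D.Nonempty := by
    obtain ⟨b, hb⟩ := X.exists_bot
    exact ⟨b, isCompactElement_of_isBot hb, Filter.mem_of_superset Filter.univ_mem fun x _ => hb x⟩
  have hD : DirectedOn (· ≤ ·) D := by
    rintro d ⟨hd, hdf⟩ e ⟨he, hef⟩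
    obtain ⟨b, hdb, heb⟩ := f.nonempty_of_mem (Filter.inter_mem hdf hef)
    obtain ⟨z, hz⟩ := hX.exists_isLUB_pair hdb heb
    refine ⟨z, ⟨isCompactElement_of_isLUB_pair hd he hz, ?_⟩, (isLUB_pair_iff.1 hz z).1 le_rfl⟩
    filter_upwards [hdf, hef] with x hdx hex using (isLUB_pair_iff.1 hz x).2 ⟨hdx, hex⟩
  obtain ⟨x, hx⟩ := X.exists_lub D hne hD
  refine ⟨x, fun d hd => ⟨fun hdx => ?_, fun hdf => hx.1 ⟨hd, hdf⟩⟩⟩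
  obtain ⟨e, ⟨-, hef⟩, hde⟩ := hd D x hne hD hx hdx
  exact Filter.mem_of_superset hef (Ici_subset_Ici.2 hde)

theorem IsScottDomain.le_nhds_scott (hX : IsScottDomain X) {f : Filter X} {x : X}
    (hf : ∀ d, IsCompactElement d → d ≤ x → Set.Ici d ∈ f) :
    f ≤ @nhds X (Topology.scott X Set.univ) x := by
  let _ : TopologicalSpace X := Topology.scott X Set.univ
  refine (nhds_basis_opens x).ge_iff.2 ?_
  rintro U ⟨hxU, hU⟩
  obtain ⟨d, hdU, hd, hdx⟩ := ScottOpen.exists_isCompactElement_le hX hU hxU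
  exact Filter.mem_of_superset (hf d hd hdx) ((scottOpen_iff.1 hU).1.Ici_subset hdU)

theorem IsScottDomain.le_nhds_lower (hX : IsScottDomain X) {f : Filter X} {x : X}
    (hf : ∀ d, IsCompactElement d → ¬d ≤ x → (Set.Ici d)ᶜ ∈ f) :
    f ≤ @nhds X (Topology.lower X) x := by
  let _ : TopologicalSpace X := Topology.lower X
  have : IsLower X := ⟨rfl⟩
  refine Filter.tendsto_id'.1 (IsLower.tendsto_nhds_iff_not_le.2 fun b hb => ?_)
  obtain ⟨d, hd, hdb, hdx⟩ : ∃ d, IsCompactElement d ∧ d ≤ b ∧ ¬d ≤ x := by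
    contrapose! hb
    exact hX.le_of_forall_isCompactElement hb
  filter_upwards [hf d hd hdx] with y hdy hby using hdy (hdb.trans hby)

theorem LowerClosed.compactSaturated (hX : IsScottDomain X) (hQ : LowerClosed X Q) :
    CompactSaturated X Q := by
  refine ⟨(@isCompact_iff_ultrafilter_le_nhds X (Topology.scott X Set.univ) Q).2
    fun f hfQ => ?_, hQ.isUpperSet⟩
  obtain ⟨x, hx⟩ := hX.exists_forall_le_iff_Ici_mem f
  have hscott : ↑f ≤ @nhds X (Topology.scott X Set.univ) x :=
    hX.le_nhds_scott fun d hd => (hx d hd).1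
  have hlower : ↑f ≤ @nhds X (Topology.lower X) x :=
    hX.le_nhds_lower fun d hd hdx => Ultrafilter.compl_mem_iff_notMem.2 (mt (hx d hd).2 hdx)
  have hxQ : x ∈ Q :=
    (@isClosed_iff_ultrafilter X Q (Topology.lower X)).1 hQ x f hlower
      (Filter.le_principal_iff.1 hfQ)
  exact ⟨x, hxQ, hscott⟩

end LowerClosed

section Products

variable {X Y : Cpo}

/-- The least element of a cpo. -/
noncomputable def Cpo.bot (X : Cpo) : X := X.exists_bot.choose

theorem Cpo.bot_le (x : X) : X.bot ≤ x := X.exists_bot.choose_spec x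

theorem prodCpo_le_iff {p q : prodCpo X Y} : p ≤ q ↔ p.1 ≤ q.1 ∧ p.2 ≤ q.2 := Iff.rfl

theorem galoisConnection_fst :
    GaloisConnection (fun x : X => ((x, Y.bot) : prodCpo X Y)) (fun p : prodCpo X Y => p.1) :=
  fun _ p => prodCpo_le_iff.trans (and_iff_left (Cpo.bot_le p.2))

theorem galoisConnection_snd :
    GaloisConnection (fun y : Y => ((X.bot, y) : prodCpo X Y)) (fun p : prodCpo X Y => p.2) :=
  fun _ p => prodCpo_le_iff.trans (and_iff_right (Cpo.bot_le p.1))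

theorem scottContinuous_prodCpo_fst : ScottContinuous fun p : prodCpo X Y => p.1 :=
  ScottContinuous.fst

theorem scottContinuous_prodCpo_snd : ScottContinuous fun p : prodCpo X Y => p.2 :=
  ScottContinuous.snd

theorem IsScottDomain.prod (hX : IsScottDomain X) (hY : IsScottDomain Y) :
    IsScottDomain (prodCpo X Y) := by
  refine .of_le (fun p b h => ⟨?_, ?_⟩) fun p q b hp hq => ?_
  · exact hX.rightAdjoint_le_of_forall_isCompactElement galoisConnection_fst
      scottContinuous_prodCpo_fst h
  · exact hY.rightAdjoint_le_of_forall_isCompactElement galoisConnection_snd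
      scottContinuous_prodCpo_snd h
  · obtain ⟨x, hx⟩ := hX.exists_isLUB_pair hp.1 hq.1
    obtain ⟨y, hy⟩ := hY.exists_isLUB_pair hp.2 hq.2
    exact ⟨(x, y), isLUB_pair_iff.2 fun c => (and_congr (isLUB_pair_iff.1 hx c.1)
      (isLUB_pair_iff.1 hy c.2)).trans and_and_and_comm⟩

end Products

section Summands

/-- A map identifying `X` with one of the summands of the weak sum `S`: an upward-closed copy of `X`
inside `S` with only the least element of `S` below it. -/
structure IsSummandInclusion {X S : Cpo} (i : X → S) : Prop where
  le_iff : ∀ x y, i x ≤ i y ↔ x ≤ y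
  exists_eq_of_le : ∀ x s, i x ≤ s → ∃ y, i y = s
  not_isBot : ∀ x, ¬IsBot (i x)
  isBot_or_exists_eq : ∀ x s, s ≤ i x → IsBot s ∨ ∃ y, i y = s

variable {X Y S : Cpo} {i : X → S}

namespace IsSummandInclusion

theorem injective (hi : IsSummandInclusion i) : Function.Injective i :=
  fun x y h => le_antisymm ((hi.le_iff x y).1 h.le) ((hi.le_iff y x).1 h.ge)

theorem isUpperSet_range (hi : IsSummandInclusion i) : IsUpperSet (range i) := by
  rintro _ s hs ⟨x, rfl⟩
  exact hi.exists_eq_of_le x s hs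

theorem range_eq_Ici (hi : IsSummandInclusion i) : range i = Ici (i X.bot) := by
  refine Subset.antisymm ?_ (hi.isUpperSet_range.Ici_subset ⟨_, rfl⟩)
  rintro _ ⟨x, rfl⟩
  exact (hi.le_iff _ _).2 (Cpo.bot_le x)

theorem scottOpen_range (hi : IsSummandInclusion i) : ScottOpen S (range i) := by
  refine scottOpen_iff.2 ⟨hi.isUpperSet_range, ?_⟩
  rintro D hne - _ ha ⟨x, rfl⟩
  by_contra hD
  have hbot : ∀ s ∈ D, IsBot s := fun s hs =>
    (hi.isBot_or_exists_eq x s (ha.1 hs)).resolve_right fun h => hD ⟨s, hs, h⟩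
  obtain ⟨s, hs⟩ := hne
  exact hi.not_isBot x fun b => (ha.2 fun s' hs' => hbot s' hs' s).trans (hbot s hs b)

theorem scottOpen_image (hi : IsSummandInclusion i) {U : Set X} (hU : ScottOpen X U) :
    ScottOpen S (i '' U) := by
  obtain ⟨hUup, hUacc⟩ := scottOpen_iff.1 hU
  refine scottOpen_iff.2 ⟨?_, ?_⟩
  · rintro _ s hs ⟨x, hx, rfl⟩
    obtain ⟨y, rfl⟩ := hi.exists_eq_of_le x s hs
    exact ⟨y, hUup ((hi.le_iff x y).1 hs) hx, rfl⟩
  · rintro D hne hD _ ha ⟨x, hx, rfl⟩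
    obtain ⟨_, hyD, ⟨y, rfl⟩⟩ := (scottOpen_iff.1 hi.scottOpen_range).2 hne hD ha ⟨x, rfl⟩
    have hpre : DirectedOn (· ≤ ·) (i ⁻¹' D) :=
      directedOn_preimage hi.le_iff hi.exists_eq_of_le hD
    obtain ⟨a, ha'⟩ := X.exists_lub _ ⟨y, hyD⟩ hpre
    obtain rfl : a = x := hi.injective <|
      (isLUB_of_preimage hi.le_iff hi.exists_eq_of_le hD hyD ha').unique ha
    obtain ⟨z, hzD, hzU⟩ := hUacc ⟨y, hyD⟩ hpre ha' hx
    exact ⟨i z, hzD, z, hzU, rfl⟩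

theorem lowerClosed_image (hi : IsSummandInclusion i) {Q : Set X} (hQ : LowerClosed X Q) :
    LowerClosed S (i '' Q) := by
  let p : S → X := Function.extend i id fun _ => X.bot
  have hp : ∀ x, p (i x) = x := hi.injective.extend_apply id _
  have hpre : ∀ a, LowerClosed S (p ⁻¹' Ici a) := fun a => by
    by_cases ha : a ≤ X.bot
    · convert LowerClosed.univ S using 1
      exact eq_univ_of_forall fun s => ha.trans (Cpo.bot_le (p s))
    · convert LowerClosed.Ici (i a) using 1
      ext s
      by_cases hs : ∃ x, i x = s
      · obtain ⟨x, rfl⟩ := hs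
        rw [mem_preimage, hp, mem_Ici, mem_Ici, hi.le_iff]
      · have hps : p s = X.bot := Function.extend_apply' _ _ _ hs
        rw [mem_preimage, hps]
        exact iff_of_false ha fun h => hs (hi.exists_eq_of_le a s h)
  have himage : i '' Q = Ici (i X.bot) ∩ p ⁻¹' Q := by
    ext s
    rw [← hi.range_eq_Ici]
    constructor
    · rintro ⟨x, hx, rfl⟩
      exact ⟨⟨x, rfl⟩, mem_preimage.2 (by rwa [hp])⟩
    · rintro ⟨⟨x, rfl⟩, hx⟩
      exact ⟨x, hp x ▸ hx, rfl⟩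
  rw [himage]
  exact (LowerClosed.Ici _).inter (hQ.preimage hpre)

theorem image_Ici (hi : IsSummandInclusion i) (d : X) : i '' Ici d = Ici (i d) := by
  ext s
  constructor
  · rintro ⟨x, hx, rfl⟩
    exact (hi.le_iff d x).2 hx
  · intro hs
    obtain ⟨x, rfl⟩ := hi.exists_eq_of_le d s hs
    exact ⟨x, (hi.le_iff d x).1 hs, rfl⟩

theorem isCompactElement (hi : IsSummandInclusion i) {d : X} (hd : IsCompactElement d) :
    IsCompactElement (i d) := by
  rw [← scottOpen_Ici_iff, ← hi.image_Ici]
  exact hi.scottOpen_image (scottOpen_Ici_iff.2 hd)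

theorem isLUB_pair (hi : IsSummandInclusion i) {x y z : X} (hz : IsLUB {x, y} z) :
    IsLUB {i x, i y} (i z) := by
  refine isLUB_pair_iff.2 fun s => ⟨fun h => ?_, fun ⟨hx, hy⟩ => ?_⟩
  · obtain ⟨b, rfl⟩ := hi.exists_eq_of_le z s h
    simpa only [hi.le_iff] using (isLUB_pair_iff.1 hz b).1 ((hi.le_iff z b).1 h)
  · obtain ⟨b, rfl⟩ := hi.exists_eq_of_le x s hx
    rw [hi.le_iff] at hx hy ⊢
    exact (isLUB_pair_iff.1 hz b).2 ⟨hx, hy⟩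

end IsSummandInclusion

theorem isLUB_pair_of_le {α : Type*} [PartialOrder α] {x y : α} (h : x ≤ y) : IsLUB {x, y} y :=
  isLUB_pair_iff.2 fun _ => ⟨fun hb => ⟨h.trans hb, hb⟩, And.right⟩

theorem IsScottDomain.of_summands
    (h : ∀ s : S, IsBot s ∨
      ∃ (X : Cpo) (i : X → S), IsScottDomain X ∧ IsSummandInclusion i ∧ s ∈ range i) :
    IsScottDomain S := by
  refine .of_le (fun s b hsb => ?_) fun s t b hsb htb => ?_
  · obtain hs | ⟨X, i, hX, hi, x, rfl⟩ := h s
    · exact hs b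
    have hle : ∀ d, IsCompactElement d → d ≤ x → i d ≤ b := fun d hd hdx =>
      hsb _ (hi.isCompactElement hd) ((hi.le_iff d x).2 hdx)
    obtain ⟨c, rfl⟩ := hi.exists_eq_of_le _ b
      (hle X.bot (isCompactElement_of_isBot Cpo.bot_le) (Cpo.bot_le x))
    exact (hi.le_iff x c).2 <| hX.le_of_forall_isCompactElement fun d hd hdx =>
      (hi.le_iff d c).1 (hle d hd hdx)
  · obtain hs | ⟨X, i, hX, hi, x, rfl⟩ := h s
    · exact ⟨t, isLUB_pair_of_le (hs t)⟩
    obtain ⟨c, rfl⟩ := hi.exists_eq_of_le x b hsb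
    obtain ht | ⟨y, rfl⟩ := hi.isBot_or_exists_eq c t htb
    · exact ⟨i x, pair_comm t (i x) ▸ isLUB_pair_of_le (ht (i x))⟩
    obtain ⟨z, hz⟩ := hX.exists_isLUB_pair ((hi.le_iff x c).1 hsb) ((hi.le_iff y c).1 htb)
    exact ⟨i z, hi.isLUB_pair hz⟩

theorem sumCpo_bot_le (s : sumCpo X Y) : (⊥ : WithBot (X ⊕ Y)) ≤ s :=
  OrderBot.bot_le (α := WithBot (X ⊕ Y)) s

theorem isSummandInclusion_sumInl : IsSummandInclusion (S := sumCpo X Y) sumInl where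
  le_iff := sumInl_le_iff
  exists_eq_of_le := sumInl_up
  not_isBot _ h := WithBot.not_coe_le_bot _ (h (⊥ : WithBot (X ⊕ Y)))
  isBot_or_exists_eq x s h := by
    obtain rfl | ⟨y, rfl⟩ | ⟨y, rfl⟩ := sum_cases s
    · exact .inl sumCpo_bot_le
    · exact .inr ⟨y, rfl⟩
    · exact (Sum.not_inr_le_inl (WithBot.coe_le_coe.1 h)).elim

theorem isSummandInclusion_sumInr : IsSummandInclusion (S := sumCpo X Y) sumInr where
  le_iff := sumInr_le_iff
  exists_eq_of_le := sumInr_up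
  not_isBot _ h := WithBot.not_coe_le_bot _ (h (⊥ : WithBot (X ⊕ Y)))
  isBot_or_exists_eq x s h := by
    obtain rfl | ⟨y, rfl⟩ | ⟨y, rfl⟩ := sum_cases s
    · exact .inl sumCpo_bot_le
    · exact (Sum.not_inl_le_inr (WithBot.coe_le_coe.1 h)).elim
    · exact .inr ⟨y, rfl⟩

theorem IsScottDomain.sum (hX : IsScottDomain X) (hY : IsScottDomain Y) :
    IsScottDomain (sumCpo X Y) := by
  refine .of_summands fun s => ?_
  obtain rfl | ⟨x, rfl⟩ | ⟨y, rfl⟩ := sum_cases s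
  · exact .inl sumCpo_bot_le
  · exact .inr ⟨X, sumInl, hX, isSummandInclusion_sumInl, x, rfl⟩
  · exact .inr ⟨Y, sumInr, hY, isSummandInclusion_sumInr, y, rfl⟩

theorem isSummandInclusion_true :
    IsSummandInclusion (X := oneCpo) (S := twoCpo) fun _ => True where
  le_iff _ _ := iff_of_true (fun h => h) le_rfl
  exists_eq_of_le _ s h := ⟨(), (eq_true (h trivial : s)).symm⟩
  not_isBot _ h := h False trivial
  isBot_or_exists_eq _ s _ := by
    obtain hs | hs := Classical.em s
    · exact .inr ⟨(), (eq_true hs).symm⟩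
    · exact .inl fun _ h => (hs h).elim

theorem isScottDomain_twoCpo : IsScottDomain twoCpo := by
  refine .of_summands fun s => ?_
  obtain hs | hs := isSummandInclusion_true.isBot_or_exists_eq () s fun _ => trivial
  · exact .inl hs
  · exact .inr ⟨oneCpo, _, isScottDomain_oneCpo, isSummandInclusion_true, hs⟩

end Summands

section FunctionSpaces

theorem scottContinuous_of_isLUB_pair {α β : Type*} [Preorder α] [PartialOrder β]
    {f g h : α → β} (hf : ScottContinuous f) (hg : ScottContinuous g)
    (hh : ∀ x, IsLUB {f x, g x} (h x)) : ScottContinuous h := by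
  intro D hne hD a ha
  refine isLUB_iff_le_iff.2 fun b => ?_
  have hfa := isLUB_iff_le_iff.1 (hf hne hD ha) b
  have hga := isLUB_iff_le_iff.1 (hg hne hD ha) b
  simp only [mem_upperBounds, forall_mem_image] at hfa hga ⊢
  simp only [isLUB_pair_iff.1 (hh _) b, hfa, hga, forall₂_and]

variable {X Y : Cpo}

theorem scottContinuous_eval (x : X) : ScottContinuous fun f : funCpo X Y => f.1 x := by
  intro D hne hD f hf
  obtain ⟨g, hg, hgx⟩ := exists_pointwise_lub D hne hD
  exact hg.unique hf ▸ hgx x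

theorem funCpo_le_of_forall_isCompactElement (hX : IsScottDomain X) {f g : funCpo X Y}
    (h : ∀ d, IsCompactElement d → f.1 d ≤ g.1 d) : f ≤ g := fun x =>
  (f.2 (hX.approx_nonempty x) (hX.approx_directed x) (hX.approx_isLUB x)).2 <|
    forall_mem_image.2 fun d hd => (h d hd.1).trans (g.2.monotone hd.2)

open Classical in
/-- The step function with value `e` above the compact element `d`, and the least value elsewhere;
evaluation at `d` is right adjoint to `stepFun hd`. -/
noncomputable def stepFun {d : X} (hd : IsCompactElement d) (e : Y) : funCpo X Y :=
  ⟨fun x => if d ≤ x then e else Y.bot, fun D hne hD a ha => by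
    have hle : ∀ x b, (if d ≤ x then e else Y.bot) ≤ b ↔ (d ≤ x → e ≤ b) := fun x b => by
      split_ifs with hdx <;> simp only [hdx, true_imp_iff, false_imp_iff, Cpo.bot_le]
    have hda : d ≤ a ↔ ∃ x ∈ D, d ≤ x :=
      ⟨hd D a hne hD ha, fun ⟨x, hx, hdx⟩ => hdx.trans (ha.1 hx)⟩
    refine isLUB_iff_le_iff.2 fun b => ?_
    rw [hle, hda]
    simp only [mem_upperBounds, forall_mem_image, hle, forall_exists_index, and_imp]⟩

theorem galoisConnection_stepFun {d : X} (hd : IsCompactElement d) :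
    GaloisConnection (stepFun hd) fun f : funCpo X Y => f.1 d := by
  intro e f
  constructor
  · intro h
    simpa only [stepFun, le_refl, if_true] using h d
  · intro h x
    by_cases hdx : d ≤ x
    · simpa only [stepFun, if_pos hdx] using h.trans (f.2.monotone hdx)
    · simpa only [stepFun, if_neg hdx] using Cpo.bot_le _

theorem IsScottDomain.arrow (hX : IsScottDomain X) (hY : IsScottDomain Y) :
    IsScottDomain (funCpo X Y) := by
  refine .of_le (fun f b h => ?_) fun f g b hf hg => ?_
  · exact funCpo_le_of_forall_isCompactElement hX fun d hd =>
      hY.rightAdjoint_le_of_forall_isCompactElement (galoisConnection_stepFun hd)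
        (scottContinuous_eval d) h
  · choose z hz using fun x => hY.exists_isLUB_pair (hf x) (hg x)
    refine ⟨⟨z, scottContinuous_of_isLUB_pair f.2 g.2 hz⟩, isLUB_pair_iff.2 fun c => ?_⟩
    exact (forall_congr' fun x => isLUB_pair_iff.1 (hz x) (c.1 x)).trans forall_and

end FunctionSpaces

section ExhaustingCocones

theorem EP.galoisConnection {X Y : Cpo} (f : X ⟶ Y) : GaloisConnection (EP.emb f) (EP.proj f) :=
  fun x y => ⟨fun h => (EP.proj_emb f x).symm.le.trans ((EP.proj_cont f).monotone h),
    fun h => ((EP.emb_cont f).monotone h).trans (EP.emb_proj f y)⟩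

/-- A family of embedding-projection pairs into `C` is exhausting when the identity of `C` is the
pointwise supremum of the idempotents `emb ∘ proj`. Only the nontrivial half is recorded: these
idempotents always lie below the identity. -/
def IsExhausting {K : ℕ → Cpo} {C : Cpo} (t : ∀ m, K m ⟶ C) : Prop :=
  ∀ y b : C, (∀ m, EP.emb (t m) (EP.proj (t m) y) ≤ b) → y ≤ b

variable {K : ℕ → Cpo} {k : ∀ m, K m ⟶ K (m + 1)} {C : Cpo} {t : ∀ m, K m ⟶ C}

theorem IsExhausting.forall_le_iff (h : IsExhausting t) {y b : C} :
    (∀ m, EP.emb (t m) (EP.proj (t m) y) ≤ b) ↔ y ≤ b :=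
  ⟨h y b, fun hyb m => (EP.emb_proj (t m) y).trans hyb⟩

theorem IsExhausting.isLUB (h : IsExhausting t) (y : C) :
    IsLUB (range fun m => EP.emb (t m) (EP.proj (t m) y)) y := by
  refine isLUB_iff_le_iff.2 fun b => ?_
  rw [← h.forall_le_iff, mem_upperBounds, forall_mem_range]

theorem IsExhausting.of_succ (h : IsExhausting fun m => t (m + 1)) : IsExhausting t :=
  fun y b hb => h y b fun m => hb (m + 1)

theorem isExhausting_id (C : Cpo) : IsExhausting fun _ => 𝟙 C := fun _ _ h => h 0

theorem isExhausting_limIn (K : ℕ → Cpo) (k : ∀ m, K m ⟶ K (m + 1)) :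
    IsExhausting (limIn K k) :=
  fun y b h m => (EP.galoisConnection (limIn K k m) (y.1 m) b).1 (h m)

theorem monotone_cocone_emb_proj (ht : ∀ m, k m ≫ t (m + 1) = t m) (y : C) :
    Monotone fun m => EP.emb (t m) (EP.proj (t m) y) :=
  monotone_nat_of_le_succ fun m => by
    rw [← ht m]
    exact (EP.emb_cont (t (m + 1))).monotone (EP.emb_proj (k m) _)

theorem IsExhausting.isScottDomain (ht : ∀ m, k m ≫ t (m + 1) = t m) (h : IsExhausting t)
    (hK : ∀ m, IsScottDomain (K m)) : IsScottDomain C := by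
  refine .of_le (fun x b hxb => ?_) fun x y b hx hy => ?_
  · refine h x b fun m => (EP.galoisConnection (t m) _ b).2 ?_
    exact (hK m).rightAdjoint_le_of_forall_isCompactElement (EP.galoisConnection (t m))
      (EP.proj_cont (t m)) hxb
  · choose z hz using fun m => (hK m).exists_isLUB_pair
      ((EP.proj_cont (t m)).monotone hx) ((EP.proj_cont (t m)).monotone hy)
    have hle : ∀ m c, EP.emb (t m) (z m) ≤ c ↔
        EP.emb (t m) (EP.proj (t m) x) ≤ c ∧ EP.emb (t m) (EP.proj (t m) y) ≤ c := fun m c => by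
      simp only [(EP.galoisConnection (t m)).le_iff_le, isLUB_pair_iff.1 (hz m)]
    have hmono : Monotone fun m => EP.emb (t m) (z m) := fun m m' hm => by
      obtain ⟨hxz, hyz⟩ := (hle m' _).1 le_rfl
      exact (hle m _).2 ⟨(monotone_cocone_emb_proj ht x hm).trans hxz,
        (monotone_cocone_emb_proj ht y hm).trans hyz⟩
    obtain ⟨w, hw⟩ := C.exists_lub _ (range_nonempty _) (directedOn_range.2 hmono.directed_le)
    refine ⟨w, isLUB_pair_iff.2 fun c => ?_⟩
    rw [isLUB_iff_le_iff.1 hw, mem_upperBounds, forall_mem_range]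
    simp only [hle, forall_and, h.forall_le_iff]

theorem isIso_of_emb_proj {X Y : Cpo} {f : X ⟶ Y} (h : ∀ y, EP.emb f (EP.proj f y) = y) :
    IsIso f :=
  let g : Y ⟶ X := ⟨EP.proj f, EP.emb f, EP.proj_cont f, EP.emb_cont f, h,
    fun x => (EP.proj_emb f x).le⟩
  ⟨g, hom_ext (EP.proj_emb f), hom_ext h⟩

theorem EP.galoisConnection_of_isIso {X Y : Cpo} (f : X ⟶ Y) [IsIso f] :
    GaloisConnection (EP.proj f) (EP.emb f) := by
  have hproj : ∀ y, EP.emb (inv f) y = EP.proj f y := fun y => by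
    rw [← EP.proj_emb f (EP.emb (inv f) y), ← comp_emb, IsIso.inv_hom_id, id_emb]
  have hemb : ∀ y, EP.emb f (EP.proj f y) = y := fun y => by
    rw [← hproj, ← comp_emb, IsIso.inv_hom_id, id_emb]
  exact fun y x => ⟨fun h => (hemb y).ge.trans ((EP.emb_cont f).monotone h),
    fun h => ((EP.proj_cont f).monotone h).trans (EP.proj_emb f x).le⟩

theorem IsExhausting.isIso_limDesc (ht : ∀ m, k m ≫ t (m + 1) = t m) (h : IsExhausting t) :
    IsIso (limDesc t ht) :=
  isIso_of_emb_proj fun y => (descEmb_isLUB t ht _).unique (h.isLUB y)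

variable {X Y : ℕ → Cpo} {A B : Cpo} {f : ∀ m, X m ⟶ A} {g : ∀ m, Y m ⟶ B}

theorem IsExhausting.prodEP (hf : IsExhausting f) (hg : IsExhausting g) :
    IsExhausting fun m => prodEP (f m) (g m) := fun y b h =>
  ⟨hf y.1 b.1 fun m => (h m).1, hg y.2 b.2 fun m => (h m).2⟩

theorem IsExhausting.sumEP (hf : IsExhausting f) (hg : IsExhausting g) :
    IsExhausting fun m => sumEP (f m) (g m) := by
  intro y b h
  obtain rfl | ⟨y, rfl⟩ | ⟨y, rfl⟩ := sum_cases y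
  · exact sumCpo_bot_le b
  · obtain ⟨b, rfl⟩ := sumInl_up _ _ (h 0)
    exact (sumInl_le_iff _ _).2 (hf y b fun m => (sumInl_le_iff _ _).1 (h m))
  · obtain ⟨b, rfl⟩ := sumInr_up _ _ (h 0)
    exact (sumInr_le_iff _ _).2 (hg y b fun m => (sumInr_le_iff _ _).1 (h m))

theorem IsExhausting.funEP {p : ∀ m, X m ⟶ X (m + 1)} {q : ∀ m, Y m ⟶ Y (m + 1)}
    (hpf : ∀ m, p m ≫ f (m + 1) = f m) (hqg : ∀ m, q m ≫ g (m + 1) = g m)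
    (hf : IsExhausting f) (hg : IsExhausting g) :
    IsExhausting fun m => funEP (f m) (g m) := by
  intro φ b h x
  have hmono := monotone_cocone_emb_proj hpf x
  refine (φ.2 (range_nonempty _) (directedOn_range.2 hmono.directed_le) (hf.isLUB x)).2 ?_
  rw [mem_upperBounds, forall_mem_image, forall_mem_range]
  refine fun l => hg _ _ fun m => ?_
  let n := max l m
  calc EP.emb (g m) (EP.proj (g m) (φ.1 (EP.emb (f l) (EP.proj (f l) x))))
      ≤ EP.emb (g n) (EP.proj (g n) (φ.1 (EP.emb (f l) (EP.proj (f l) x)))) :=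
        monotone_cocone_emb_proj hqg _ (le_max_right l m)
    _ ≤ EP.emb (g n) (EP.proj (g n) (φ.1 (EP.emb (f n) (EP.proj (f n) x)))) :=
        (EP.emb_cont (g n)).monotone <| (EP.proj_cont (g n)).monotone <|
          φ.2.monotone (hmono (le_max_left l m))
    _ ≤ b.1 x := h n x

end ExhaustingCocones

section Types

variable {n : ℕ}

theorem isScottDomain_chainObj {F : Env (n + 1) ⥤ Cpo}
    (hF : ∀ X : Env (n + 1), (∀ i, IsScottDomain (X i)) → IsScottDomain (F.obj X))
    {X : Env n} (hX : ∀ i, IsScottDomain (X i)) : ∀ m, IsScottDomain (chainObj F X m)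
  | 0 => isScottDomain_oneCpo
  | m + 1 => hF (Env.cons (chainObj F X m) X) <|
      Fin.cases (isScottDomain_chainObj hF hX m) hX

theorem Ty.isScottDomain_sem : {n : ℕ} → (T : Ty n) → (X : Env n) →
    (∀ i, IsScottDomain (X i)) → IsScottDomain (T.sem.obj X)
  | _, unit, _, _ => isScottDomain_twoCpo
  | _, prod S T, X, hX => (S.isScottDomain_sem X hX).prod (T.isScottDomain_sem X hX)
  | _, arrow S T, X, hX => (S.isScottDomain_sem X hX).arrow (T.isScottDomain_sem X hX)
  | _, sum S T, X, hX => (S.isScottDomain_sem X hX).sum (T.isScottDomain_sem X hX)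
  | _, var i, _, hX => hX i
  | _, recTy T, _, hX => (isExhausting_limIn _ _).isScottDomain (limIn_comp _ _)
      (isScottDomain_chainObj T.isScottDomain_sem hX)

theorem Ty.isScottDomain_dom (T : PureTy) : IsScottDomain T.dom :=
  T.isScottDomain_sem _ nofun

/-- A functor on environments is ω-continuous when it preserves exhausting cocones, the
componentwise bilimits of ω-chains of embedding-projection pairs. -/
def IsOmegaContinuous (F : Env n ⥤ Cpo) : Prop :=
  ∀ (X : ℕ → Env n) (k : ∀ m, X m ⟶ X (m + 1)) (C : Env n) (t : ∀ m, X m ⟶ C),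
    (∀ m, k m ≫ t (m + 1) = t m) → (∀ i, IsExhausting fun m => t m i) →
    IsExhausting fun m => F.map (t m)

variable {F G : Env n ⥤ Cpo}

theorem IsOmegaContinuous.prodF (hF : IsOmegaContinuous F) (hG : IsOmegaContinuous G) :
    IsOmegaContinuous (prodF F G) := fun X k C t ht he =>
  (hF X k C t ht he).prodEP (hG X k C t ht he)

theorem IsOmegaContinuous.sumF (hF : IsOmegaContinuous F) (hG : IsOmegaContinuous G) :
    IsOmegaContinuous (sumF F G) := fun X k C t ht he =>
  (hF X k C t ht he).sumEP (hG X k C t ht he)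

theorem IsOmegaContinuous.funF (hF : IsOmegaContinuous F) (hG : IsOmegaContinuous G) :
    IsOmegaContinuous (funF F G) := fun X k C t ht he =>
  .funEP (p := fun m => F.map (k m)) (q := fun m => G.map (k m))
    (fun m => by rw [← F.map_comp, ht]) (fun m => by rw [← G.map_comp, ht])
    (hF X k C t ht he) (hG X k C t ht he)

theorem isExhausting_consMap {K : ℕ → Cpo} {A : Cpo} {f : ∀ m, K m ⟶ A} (hf : IsExhausting f)
    {X : ℕ → Env n} {C : Env n} {t : ∀ m, X m ⟶ C} (ht : ∀ i, IsExhausting fun m => t m i) :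
    ∀ i, IsExhausting fun m => consMap (f m) (t m) i :=
  Fin.cases hf ht

theorem isExhausting_chainMap {F : Env (n + 1) ⥤ Cpo} (hF : IsOmegaContinuous F)
    (X : ℕ → Env n) (k : ∀ m, X m ⟶ X (m + 1)) (C : Env n) (t : ∀ m, X m ⟶ C)
    (ht : ∀ m, k m ≫ t (m + 1) = t m) (he : ∀ i, IsExhausting fun m => t m i) :
    ∀ j, IsExhausting fun m => chainMap F (t m) j
  | 0 => fun _ _ _ => le_rfl
  | j + 1 => hF (fun m => Env.cons (chainObj F (X m) j) (X m))
      (fun m => consMap (chainMap F (k m) j) (k m)) (Env.cons (chainObj F C j) C)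
      (fun m => consMap (chainMap F (t m) j) (t m))
      (fun m => by rw [← consMap_comp, ← chainMap_comp, ht])
      (isExhausting_consMap (isExhausting_chainMap hF X k C t ht he j) he)

theorem IsOmegaContinuous.recF {F : Env (n + 1) ⥤ Cpo} (hF : IsOmegaContinuous F) :
    IsOmegaContinuous (recF F) := by
  intro X k C t ht he y b h j
  refine isExhausting_chainMap hF X k C t ht he j _ _ fun m => ?_
  refine (EP.galoisConnection (limIn (chainObj F C) (chainStep F C) j) _ b).1 (le_trans ?_ (h m))
  exact (descEmb_isLUB (fun j => chainMap F (t m) j ≫ limIn _ (chainStep F C) j)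
    (fun j => by rw [← Category.assoc, chainMap_step, Category.assoc, limIn_comp])
    (EP.proj ((PolarLogic.recF F).map (t m)) y)).1 ⟨j, rfl⟩

theorem Ty.isOmegaContinuous_sem : {n : ℕ} → (T : Ty n) → IsOmegaContinuous T.sem
  | _, unit => fun _ _ _ _ _ _ => isExhausting_id twoCpo
  | _, prod S T => S.isOmegaContinuous_sem.prodF T.isOmegaContinuous_sem
  | _, arrow S T => S.isOmegaContinuous_sem.funF T.isOmegaContinuous_sem
  | _, sum S T => S.isOmegaContinuous_sem.sumF T.isOmegaContinuous_sem
  | _, var i => fun _ _ _ _ _ he => he i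
  | _, recTy T => T.isOmegaContinuous_sem.recF

theorem isIso_unfoldHom {F : Env (n + 1) ⥤ Cpo} (hF : IsOmegaContinuous F) (X : Env n) :
    IsIso (unfoldHom F X) :=
  IsExhausting.isIso_limDesc _ <| .of_succ <|
    hF (fun m => Env.cons (chainObj F X m) X) (fun m => consMap (chainStep F X m) (𝟙 X)) _
      (fun m => consMap (limIn (chainObj F X) (chainStep F X) m) (𝟙 X))
      (fun m => by rw [← consMap_comp, limIn_comp, Category.comp_id])
      (isExhausting_consMap (isExhausting_limIn _ _) fun _ => isExhausting_id _)

theorem Ty.scottContinuous_unfold (T : Ty 1) : ScottContinuous T.unfold := EP.emb_cont _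

theorem Ty.exists_galoisConnection_unfold (T : Ty 1) : ∃ l, GaloisConnection l T.unfold := by
  have hiso := IsIso.comp_isIso' (isIso_unfoldHom T.isOmegaContinuous_sem Fin.elim0)
    (instIsIsoEqToHom (sem_inst_obj T (recTy T) Fin.elim0).symm)
  exact ⟨_, @EP.galoisConnection_of_isIso _ _ _ hiso⟩

end Types

section Polarity

variable {X Y : Cpo}

theorem scottOpen_arrow {Q : Set X} (hQ : ScottCompact X Q) {U : Set Y} (hU : ScottOpen Y U) :
    ScottOpen (funCpo X Y) {f : funCpo X Y | ∀ x ∈ Q, f.1 x ∈ U} := by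
  obtain ⟨hUup, hUdir⟩ := scottOpen_iff.1 hU
  refine scottOpen_iff.2 ⟨fun f g hfg hf x hx => hUup (hfg x) (hf x hx),
    fun D hne hD f hf hfU => ?_⟩
  let _ : TopologicalSpace X := Topology.scott X Set.univ
  have : Nonempty D := hne.to_subtype
  have hcover : Q ⊆ ⋃ g : D, g.1.1 ⁻¹' U := fun x hx => by
    obtain ⟨_, ⟨g, hg, rfl⟩, hgU⟩ := hUdir (hne.image _)
      (directedOn_image_of_monotone (scottContinuous_eval x).monotone hD)
      (scottContinuous_eval x hne hD hf) (hfU x hx)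
    exact mem_iUnion.2 ⟨⟨g, hg⟩, hgU⟩
  have hdirected : Directed (· ⊆ ·) fun g : D => g.1.1 ⁻¹' U :=
    Directed.mono_comp (· ≤ ·) (g := fun g : funCpo X Y => g.1 ⁻¹' U)
      (fun _ _ hgh x hx => hUup (hgh x) hx) hD.directed_val
  obtain ⟨⟨g, hg⟩, hgQ⟩ := IsCompact.elim_directed_cover hQ _
    (fun g : D => ScottOpen.preimage g.1.2 hU) hcover hdirected
  exact ⟨g, hg, hgQ⟩

theorem lowerClosed_arrow (hX : IsScottDomain X) {U : Set X} (hU : ScottOpen X U) {Q : Set Y}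
    (hQ : LowerClosed Y Q) : LowerClosed (funCpo X Y) {f : funCpo X Y | ∀ x ∈ U, f.1 x ∈ Q} := by
  have htest : {f : funCpo X Y | ∀ x ∈ U, f.1 x ∈ Q} =
      ⋂ d : {d // d ∈ U ∧ IsCompactElement d}, (fun f : funCpo X Y => f.1 d) ⁻¹' Q := by
    ext f
    rw [mem_iInter]
    refine ⟨fun hf d => hf d d.2.1, fun hf x hx => ?_⟩
    obtain ⟨d, hdU, hd, hdx⟩ := hU.exists_isCompactElement_le hX hx
    exact hQ.isUpperSet (f.2.monotone hdx) (hf ⟨d, hdU, hd⟩)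
  rw [htest]
  exact .iInter fun d => hQ.preimage_rightAdjoint (galoisConnection_stepFun d.2.2)

/-- The topological property of the denotation of a formula of polarity `s`: it is Scott-open
unless `s` is negative, and closed in the lower topology unless `s` is positive. -/
def HasPolarity (X : Cpo) (s : Sign) (U : Set X) : Prop :=
  (s ≠ .neg → ScottOpen X U) ∧ (s ≠ .pos → LowerClosed X U)

theorem Sign.opp_ne_neg {s : Sign} : s.opp ≠ .neg ↔ s ≠ .pos := by
  cases s <;> simp [Sign.opp]

theorem Sign.opp_ne_pos {s : Sign} : s.opp ≠ .pos ↔ s ≠ .neg := by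
  cases s <;> simp [Sign.opp]

namespace HasPolarity

variable {s : Sign} {U V : Set X}

theorem univ : HasPolarity X s Set.univ := ⟨fun _ => .univ X, fun _ => .univ X⟩

theorem empty : HasPolarity X s ∅ := ⟨fun _ => .empty X, fun _ => .empty X⟩

theorem inter (hU : HasPolarity X s U) (hV : HasPolarity X s V) : HasPolarity X s (U ∩ V) :=
  ⟨fun hs => (hU.1 hs).inter (hV.1 hs), fun hs => (hU.2 hs).inter (hV.2 hs)⟩

theorem union (hU : HasPolarity X s U) (hV : HasPolarity X s V) : HasPolarity X s (U ∪ V) :=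
  ⟨fun hs => (hU.1 hs).union (hV.1 hs), fun hs => (hU.2 hs).union (hV.2 hs)⟩

theorem iUnion {ι : Sort*} {U : ι → Set X} (hU : ∀ i, HasPolarity X .pos (U i)) :
    HasPolarity X .pos (⋃ i, U i) :=
  ⟨fun hs => .iUnion fun i => (hU i).1 hs, fun hs => absurd rfl hs⟩

theorem iInter {ι : Sort*} {U : ι → Set X} (hU : ∀ i, HasPolarity X .neg (U i)) :
    HasPolarity X .neg (⋂ i, U i) :=
  ⟨fun hs => absurd rfl hs, fun hs => .iInter fun i => (hU i).2 hs⟩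

theorem preimage {l : Y → X} {u : X → Y} (gc : GaloisConnection l u) (hu : ScottContinuous u)
    {U : Set Y} (hU : HasPolarity Y s U) : HasPolarity X s (u ⁻¹' U) :=
  ⟨fun hs => (hU.1 hs).preimage hu, fun hs => (hU.2 hs).preimage_rightAdjoint gc⟩

theorem image {i : X → Y} (hi : IsSummandInclusion i) (hU : HasPolarity X s U) :
    HasPolarity Y s (i '' U) :=
  ⟨fun hs => hi.scottOpen_image (hU.1 hs), fun hs => hi.lowerClosed_image (hU.2 hs)⟩

theorem arrow (hX : IsScottDomain X) (hU : HasPolarity X s.opp U) {V : Set Y}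
    (hV : HasPolarity Y s V) : HasPolarity (funCpo X Y) s {f : funCpo X Y | ∀ x ∈ U, f.1 x ∈ V} :=
  ⟨fun hs => scottOpen_arrow ((hU.2 (Sign.opp_ne_pos.2 hs)).compactSaturated hX).1 (hV.1 hs),
    fun hs => lowerClosed_arrow hX (hU.1 (Sign.opp_ne_neg.2 hs)) (hV.2 hs)⟩

end HasPolarity

theorem hasPolarity_singleton_top (s : Sign) : HasPolarity twoCpo s ({⊤} : Set Prop) := by
  have : ({⊤} : Set Prop) = (fun _ : oneCpo => True) '' Set.univ :=
    (univ_nonempty (α := Unit)).image_const True |>.symm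
  exact this ▸ HasPolarity.univ.image isSummandInclusion_true

theorem FPVal.forall_cons {p : ∀ T : PureTy, Set T.dom → Prop} {Γ : Ctx} {S : PureTy}
    {P : Set S.dom} {v : FPVal Γ} (hP : p S P) (hv : ∀ T x, p T (v T x)) :
    ∀ T x, p T (FPVal.cons P v T x)
  | _, .here => hP
  | _, .there x => hv _ x

theorem Lang.hasPolarity_sem {s : Sign} {Γ : Ctx} {T : PureTy} {φ : Form Γ T} (hφ : Lang s φ)
    {v : FPVal Γ} (hv : ∀ S x, HasPolarity S.dom s (v S x)) (r : ℕ → ℕ) :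
    HasPolarity T.dom s (φ.sem v r) := by
  induction hφ generalizing r with
  | tt => exact .univ
  | ff => exact .empty
  | and _ _ hφ hψ => exact (hφ hv r).inter (hψ hv r)
  | or _ _ hφ hψ => exact (hφ hv r).union (hψ hv r)
  | pair => exact hasPolarity_singleton_top _
  | fst _ hφ => exact (hφ hv r).preimage galoisConnection_fst scottContinuous_prodCpo_fst
  | snd _ hφ => exact (hφ hv r).preimage galoisConnection_snd scottContinuous_prodCpo_snd
  | inl _ hφ => exact (hφ hv r).image isSummandInclusion_sumInl
  | inr _ hφ => exact (hφ hv r).image isSummandInclusion_sumInr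
  | @fold _ _ T _ _ hφ =>
    obtain ⟨l, gc⟩ := T.exists_galoisConnection_unfold
    exact (hφ hv r).preimage gc T.scottContinuous_unfold
  | fpvar x => exact hv _ x
  | mu _ hφ =>
    exact Function.Iterate.rec (HasPolarity _ _) .empty
      (fun _ hP => hφ (FPVal.forall_cons hP hv) r) _
  | nu _ hφ =>
    exact Function.Iterate.rec (HasPolarity _ _) .univ
      (fun _ hP => hφ (FPVal.forall_cons hP hv) r) _
  | ex _ _ hφ => exact .iUnion fun _ => hφ hv _
  | all _ _ hφ => exact .iInter fun _ => hφ hv _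
  | realto _ _ hψ hφ => exact .arrow (Ty.isScottDomain_dom _) (hψ nofun r) (hφ nofun r)

end Polarity

end PolarLogic

theorem mainTheorem7 (T : PolarLogic.PureTy) :
    PolarLogic.IsScottDomain T.dom ∧
    ∀ (φ : PolarLogic.Form [] T) (v : PolarLogic.FPVal []) (r : ℕ → ℕ),
      (PolarLogic.Lang PolarLogic.Sign.pos φ → PolarLogic.ScottOpen T.dom (φ.sem v r)) ∧
      (PolarLogic.Lang PolarLogic.Sign.neg φ → PolarLogic.CompactSaturated T.dom (φ.sem v r)) ∧
      (PolarLogic.Lang PolarLogic.Sign.neutral φ →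
        PolarLogic.CompactOpen T.dom (φ.sem v r)) := by
  have hT := T.isScottDomain_dom
  refine ⟨hT, fun φ v r => ⟨fun hφ => ?_, fun hφ => ?_, fun hφ => ?_⟩⟩
  · exact (hφ.hasPolarity_sem nofun r).1 nofun
  · exact ((hφ.hasPolarity_sem nofun r).2 nofun).compactSaturated hT
  · have h := hφ.hasPolarity_sem (v := v) nofun r
    exact ⟨((h.2 nofun).compactSaturated hT).1, h.1 nofun⟩
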